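/- Let $n>2$ be an odd integer, let $p\neq 2$ be a prime number not dividing $n$, and let $k$ be a finite extension of $\mathbb{Q}_p$ containing a primitive $n$-th root of unity. Let $E$ be an elliptic curve over $k$ with a full level-$n$ structure, i.e. such that there is an isomorphism of group schemes $E[n]\cong \mathbb{Z}/n\mathbb{Z}\times\mu_n$ over $k$. Let $L/k$ be a quadratic extension and let $E_L$ be the quadratic twist of $E$ with respect to $L$, i.e. the elliptic curve over $k$ (unique up to isomorphism) for which there is an isomorphism $\varphi$ of group schemes over $L$ from $E\times_k L$ to $E_L\times_k L$ with ${}^{\sigma}\varphi=\varphi\circ[-1]$ for the nontrivial element $\sigma\in\mathrm{Gal}(L/k)$. Then there is no nontrivial principal homogeneous space for $E_L$ over $k$ whose period, that is, the order of its class in the Weil--Châtelet group $\mathrm{WC}(E_L/k)=\mathrm{H}^1(\mathrm{Gal}(\overline{k}/k),E_L(\overline{k}))$, divides $n$. -/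

import Mathlib

open CategoryTheory AlgebraicGeometry MonoidalCategory CartesianMonoidalCategory
open scoped MonObj Obj

universe u

noncomputable section

/-! ### Elliptic curves over a field -/

/-- An elliptic curve over a field `k`: a group scheme `E` over `k` whose underlying scheme is a
smooth, proper, geometrically integral curve over `k`. -/
class IsEllipticCurve {k : Type u} [Field k] (E : Over (Spec (.of k))) [GrpObj E] : Prop where
  isProper : IsProper E.hom
  smooth : Smooth E.hom
  geometricallyIntegral : GeometricallyIntegral E.hom
  dim_eq_one : topologicalKrullDim E.left = 1

attribute [instance] IsEllipticCurve.isProper IsEllipticCurve.smooth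
  IsEllipticCurve.geometricallyIntegral

/-- The group law of an elliptic curve is commutative. -/
instance IsEllipticCurve.isCommMonObj {k : Type u} [Field k] (E : Over (Spec (.of k))) [GrpObj E]
    [IsEllipticCurve E] : IsCommMonObj E :=
  isCommMonObj_of_isProper_of_geometricallyIntegral E

/-! ### Full level-`n` structures -/

/-- The group `E[n](T)` of `T`-valued points of the kernel `E[n]` of multiplication by `n`. The
group law on the `T`-valued points `T ⟶ E` is written multiplicatively. -/
def torsionPoints {k : Type u} [Field k] (n : ℕ) (E : Over (Spec (.of k))) [GrpObj E]
    [IsEllipticCurve E] (T : Over (Spec (.of k))) : Subgroup (T ⟶ E) :=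
  (powMonoidHom n : (T ⟶ E) →* (T ⟶ E)).ker

/-- Restriction `E[n](T) → E[n](T')` along a morphism `T' ⟶ T`. -/
def torsionPoints.restrict {k : Type u} [Field k] {n : ℕ} {E : Over (Spec (.of k))} [GrpObj E]
    [IsEllipticCurve E] {T T' : Over (Spec (.of k))} (f : T' ⟶ T) (x : torsionPoints n E T) :
    torsionPoints n E T' :=
  ⟨f ≫ x.1, by
    have hx : x.1 ^ n = 1 := x.2
    change (f ≫ x.1) ^ n = 1
    rw [← MonObj.comp_pow, hx, MonObj.comp_one]⟩

/-- A full level-`n` structure on `E`: an isomorphism of group schemes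
`E[n] ≅ ℤ/nℤ × μ_n` over `k`, given (Yoneda) by group isomorphisms on `T`-valued points which are
natural in the `k`-scheme `T`. The `T`-valued points of the constant group scheme `ℤ/nℤ` are
the locally constant functions `T → ℤ/nℤ`, and those of `μ_n` are the `n`-th roots of unity
in `Γ(T, 𝒪_T)`. -/
structure FullLevelStructure {k : Type u} [Field k] (n : ℕ) (E : Over (Spec (.of k))) [GrpObj E]
    [IsEllipticCurve E] where
  equiv (T : Over (Spec (.of k))) : torsionPoints n E T ≃*
    Multiplicative (LocallyConstant T.left (ZMod n)) × rootsOfUnity n Γ(T.left, ⊤)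
  naturality_fst {T T' : Over (Spec (.of k))} (f : T' ⟶ T) (x : torsionPoints n E T) :
    (equiv T' (torsionPoints.restrict f x)).1.toAdd =
      (equiv T x).1.toAdd.comap ⟨f.left, f.left.continuous⟩
  naturality_snd {T T' : Over (Spec (.of k))} (f : T' ⟶ T) (x : torsionPoints n E T) :
    (equiv T' (torsionPoints.restrict f x)).2 = restrictRootsOfUnity f.left.appTop.hom n (equiv T x).2

/-! ### Quadratic twists -/

/-- The structure morphism `Spec L ⟶ Spec k` of a field extension `L/k`. -/
abbrev specExt (k L : Type u) [Field k] [Field L] [Algebra k L] :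
    Spec (.of L) ⟶ Spec (.of k) :=
  Spec.map (CommRingCat.ofHom (algebraMap k L))

/-- The automorphism of `Spec L` over `Spec k` induced by a `k`-automorphism of `L`. -/
abbrev specAut {k L : Type u} [Field k] [Field L] [Algebra k L] (σ : L ≃ₐ[k] L) :
    Spec (.of L) ⟶ Spec (.of L) :=
  Spec.map (CommRingCat.ofHom (σ : L →+* L))

lemma specAut_comp_specExt {k L : Type u} [Field k] [Field L] [Algebra k L] (σ : L ≃ₐ[k] L) :
    specAut σ ≫ specExt k L = specExt k L := by
  rw [← Spec.map_comp, ← CommRingCat.ofHom_comp]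
  congr 2
  ext x
  exact σ.commutes x

/-- The base change `X_L` of a `k`-scheme `X`, as an `L`-scheme. -/
abbrev baseChangeTo {k : Type u} [Field k] (L : Type u) [Field L] [Algebra k L]
    (X : Over (Spec (.of k))) : Over (Spec (.of L)) :=
  (Over.pullback (specExt k L)).obj X

/-- The semilinear automorphism `id × Spec σ` of `X_L = X ×_k Spec L`. -/
def semilinearAut {k L : Type u} [Field k] [Field L] [Algebra k L] (σ : L ≃ₐ[k] L)
    (X : Over (Spec (.of k))) : (baseChangeTo L X).left ⟶ (baseChangeTo L X).left :=
  Limits.pullback.lift (Limits.pullback.fst X.hom (specExt k L))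
    (Limits.pullback.snd X.hom (specExt k L) ≫ specAut σ)
    (by rw [Category.assoc, specAut_comp_specExt, Limits.pullback.condition])

/-- `E'` is the quadratic twist of the elliptic curve `E` with respect to the quadratic extension
`L/k`: there is an isomorphism of group schemes `φ : E_L ≅ E'_L` over `L` such that conjugating `φ`
by the nontrivial `k`-automorphism of `L` gives `φ ∘ [-1]`. This determines `E'` up to
isomorphism. -/
def IsQuadraticTwist {k : Type u} [Field k] (L : Type u) [Field L] [Algebra k L]
    (E E' : Over (Spec (.of k))) [GrpObj E] [GrpObj E'] : Prop :=
  ∃ φ : baseChangeTo L E ≅ baseChangeTo L E', IsMonHom φ.hom ∧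
    ∀ σ : L ≃ₐ[k] L, σ ≠ 1 →
      semilinearAut σ E ≫ φ.hom.left =
        (ι[baseChangeTo L E] ≫ φ.hom).left ≫ semilinearAut σ E'

/-! ### Geometric points and first Galois cohomology -/

/-- The absolute Galois group of `k` (for `k` perfect, where `k̄ = kˢ`). -/
abbrev AbsGal (k : Type u) [Field k] : Type u := AlgebraicClosure k ≃ₐ[k] AlgebraicClosure k

/-- `Spec k̄` as a `k`-scheme. -/
abbrev specBar (k : Type u) [Field k] : Over (Spec (.of k)) :=
  Over.mk (specExt k (AlgebraicClosure k))

/-- The set `X(k̄)` of geometric points of a `k`-scheme `X`. -/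
abbrev GeomPoints {k : Type u} [Field k] (X : Over (Spec (.of k))) : Type u := specBar k ⟶ X

/-- The automorphism of the `k`-scheme `Spec k̄` induced by a Galois automorphism. -/
def galAut {k : Type u} [Field k] (σ : AbsGal k) : specBar k ⟶ specBar k :=
  Over.homMk (specAut σ) (specAut_comp_specExt σ)

lemma galAut_one {k : Type u} [Field k] : galAut (1 : AbsGal k) = 𝟙 _ := by
  ext1
  exact Spec.map_id _

lemma galAut_mul {k : Type u} [Field k] (σ τ : AbsGal k) :
    galAut (σ * τ) = galAut σ ≫ galAut τ := by
  ext1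
  change Spec.map _ = Spec.map _ ≫ Spec.map _
  rw [← Spec.map_comp, ← CommRingCat.ofHom_comp]
  rfl

/-- The Galois action on `X(k̄)`. -/
instance {k : Type u} [Field k] (X : Over (Spec (.of k))) :
    MulAction (AbsGal k) (GeomPoints X) where
  smul σ P := galAut σ ≫ P
  one_smul P := by
    change galAut 1 ≫ P = P
    rw [galAut_one, Category.id_comp]
  mul_smul σ τ P := by
    change galAut (σ * τ) ≫ P = galAut σ ≫ galAut τ ≫ P
    rw [galAut_mul, Category.assoc]

lemma gal_smul_def {k : Type u} [Field k] {X : Over (Spec (.of k))} (σ : AbsGal k)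
    (P : GeomPoints X) : σ • P = galAut σ ≫ P := rfl

/-- The Galois action on `E(k̄)` is by group automorphisms. -/
instance {k : Type u} [Field k] (E : Over (Spec (.of k))) [GrpObj E] :
    MulDistribMulAction (AbsGal k) (GeomPoints E) where
  smul_mul σ P Q := by
    rw [gal_smul_def, gal_smul_def, gal_smul_def, MonObj.comp_mul]
  smul_one σ := by
    rw [gal_smul_def, MonObj.comp_one]

/-- Affine-local description of geometric points. -/
lemma exists_affine_factor {k : Type u} [Field k] (X : Over (Spec (.of k)))
    [LocallyOfFiniteType X.hom] (x : X.left) :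
    ∃ (A : CommRingCat.{u}) (j : Spec A ⟶ X.left) (g : CommRingCat.of k ⟶ A),
      IsOpenImmersion j ∧ x ∈ Set.range j ∧ j ≫ X.hom = Spec.map g ∧ g.hom.FiniteType := by
  obtain ⟨U, hU, hxU, -⟩ := exists_isAffineOpen_mem_and_subset (X := X.left) (x := x)
    (U := ⊤) trivial
  refine ⟨_, hU.fromSpec, Spec.preimage (hU.fromSpec ≫ X.hom), inferInstance, ?_, ?_, ?_⟩
  · rw [hU.range_fromSpec]; exact hxU
  · rw [Spec.map_preimage]
  · have : LocallyOfFiniteType (Spec.map (Spec.preimage (hU.fromSpec ≫ X.hom))) := by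
      rw [Spec.map_preimage]; infer_instance
    exact (HasRingHomProperty.Spec_iff (P := @LocallyOfFiniteType)).mp this

/-- A nonempty scheme locally of finite type over `k` has a geometric point. -/
lemma nonempty_geomPoints {k : Type u} [Field k] (X : Over (Spec (.of k))) [LocallyOfFiniteType X.hom]
    [Nonempty X.left] : Nonempty (GeomPoints X) := by
  obtain ⟨A, j, g, _, ⟨y, -⟩, hj, hg⟩ := exists_affine_factor X (Classical.arbitrary X.left)
  have : Nontrivial A := ⟨0, 1, fun h => y.isPrime.ne_top ((Ideal.eq_top_iff_one _).mpr
    (h ▸ y.asIdeal.zero_mem))⟩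
  obtain ⟨M, hM⟩ := Ideal.exists_maximal A
  let := Ideal.Quotient.field M
  let : Algebra k A := g.hom.toAlgebra
  have : Algebra.FiniteType k A := hg
  have : Algebra.FiniteType k (A ⧸ M) :=
    Algebra.FiniteType.of_surjective (Ideal.Quotient.mkₐ k M) Ideal.Quotient.mk_surjective
  have : Module.Finite k (A ⧸ M) := finite_of_finite_type_of_isJacobsonRing k (A ⧸ M)
  let ψ : A →ₐ[k] AlgebraicClosure k :=
    (IsAlgClosed.lift : (A ⧸ M) →ₐ[k] AlgebraicClosure k).comp (Ideal.Quotient.mkₐ k M)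
  refine ⟨Over.homMk (Spec.map (CommRingCat.ofHom ψ.toRingHom) ≫ j) ?_⟩
  rw [Category.assoc]
  erw [hj]
  rw [← Spec.map_comp]
  change Spec.map _ = Spec.map _
  congr 1
  ext a
  exact ψ.commutes a

/-- The stabilizer of a geometric point is open. -/
lemma exists_open_stabilizer {k : Type u} [Field k] {X : Over (Spec (.of k))}
    [LocallyOfFiniteType X.hom] (P : GeomPoints X) : ∃ U : Subgroup (AbsGal k), IsOpen (U : Set (AbsGal k)) ∧
      ∀ σ ∈ U, σ • P = P := by
  obtain ⟨A, j, g, _, ⟨y, hy⟩, hj, hg⟩ :=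
    exists_affine_factor X (P.left (IsLocalRing.closedPoint (AlgebraicClosure k)))
  have hr : Set.range P.left ⊆ Set.range j := by
    rintro _ ⟨t, rfl⟩
    refine ⟨y, hy.trans ?_⟩
    congr 1
    exact Subsingleton.elim (α := PrimeSpectrum (AlgebraicClosure k)) _ _
  let q : Spec (.of (AlgebraicClosure k)) ⟶ Spec A := IsOpenImmersion.lift j P.left hr
  have hq : q ≫ j = P.left := IsOpenImmersion.lift_fac _ _ _
  let ψ := Spec.preimage q
  have hψ : Spec.map ψ = q := Spec.map_preimage q
  have hk : ∀ a : k, ψ.hom (g.hom a) = algebraMap k (AlgebraicClosure k) a := by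
    have h1 : Spec.map (g ≫ ψ) = specExt k (AlgebraicClosure k) := by
      rw [Spec.map_comp, hψ, ← hj, ← Category.assoc, hq]
      exact Over.w P
    have h2 := Spec.map_injective h1
    intro a
    exact congrArg (fun f => f.hom a) h2
  let : Algebra k A := g.hom.toAlgebra
  obtain ⟨s, hs⟩ : Algebra.FiniteType k A := hg
  let ψ' : A →ₐ[k] AlgebraicClosure k := { ψ.hom with commutes' := hk }
  let F := IntermediateField.adjoin k (ψ' '' (s : Set A))
  have : FiniteDimensional k F := IntermediateField.finiteDimensional_adjoin
    (fun x _ => Algebra.IsIntegral.isIntegral x)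
  refine ⟨F.fixingSubgroup, F.fixingSubgroup_isOpen, fun σ hσ => ?_⟩
  have h3 : (σ : AlgebraicClosure k →ₐ[k] AlgebraicClosure k).comp ψ' = ψ' := by
    refine AlgHom.ext_of_adjoin_eq_top hs fun a ha => ?_
    exact (IntermediateField.mem_fixingSubgroup_iff F σ).mp hσ _
      (IntermediateField.subset_adjoin k _ ⟨a, ha, rfl⟩)
  have h4 : specAut σ ≫ q = q := by
    rw [← hψ, ← Spec.map_comp]
    congr 1
    ext a
    exact congrArg (fun f => f a) h3
  ext1
  change specAut σ ≫ P.left = P.left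
  rw [← hq, ← Category.assoc, h4]

/-- Continuous 1-cocycles of a topological group `G` with values in a discrete `G`-module `A`
(written multiplicatively). -/
def contCocycles (G A : Type*) [Group G] [TopologicalSpace G] [CommGroup A]
    [MulDistribMulAction G A] : Subgroup (G → A) where
  carrier := {z | IsLocallyConstant z ∧ groupCohomology.IsMulCocycle₁ z}
  mul_mem' := by
    rintro z w ⟨hz, hz'⟩ ⟨hw, hw'⟩
    refine ⟨hz.mul hw, fun g h => ?_⟩
    simp only [Pi.mul_apply, hz' g h, hw' g h, smul_mul']
    exact mul_mul_mul_comm _ _ _ _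
  one_mem' := ⟨IsLocallyConstant.const 1, fun g h => by simp⟩
  inv_mem' := by
    rintro z ⟨hz, hz'⟩
    refine ⟨hz.inv, fun g h => ?_⟩
    simp only [Pi.inv_apply, hz' g h, mul_inv, smul_inv']

/-- The subgroup of 1-coboundaries. -/
def contCoboundaries (G A : Type*) [Group G] [TopologicalSpace G] [CommGroup A]
    [MulDistribMulAction G A] : Subgroup (contCocycles G A) where
  carrier := {z | groupCohomology.IsMulCoboundary₁ z.1}
  mul_mem' := by
    rintro z w ⟨a, ha⟩ ⟨b, hb⟩
    refine ⟨a * b, fun g => ?_⟩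
    rw [smul_mul', mul_div_mul_comm, ha, hb]
    rfl
  one_mem' := ⟨1, fun g => by simp⟩
  inv_mem' := by
    rintro z ⟨a, ha⟩
    refine ⟨a⁻¹, fun g => ?_⟩
    rw [smul_inv', ← inv_div', ha]
    rfl

/-- The first continuous cohomology group `H¹(G, A)` of a discrete `G`-module `A`. -/
abbrev contH1 (G A : Type*) [Group G] [TopologicalSpace G] [CommGroup A]
    [MulDistribMulAction G A] : Type _ :=
  contCocycles G A ⧸ contCoboundaries G A

/-- The Weil–Châtelet group `WC(E/k) = H¹(G_k, E(k̄))`. -/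
abbrev WeilChatelet {k : Type u} [Field k] (E : Over (Spec (.of k))) [GrpObj E]
    [IsEllipticCurve E] : Type u :=
  contH1 (AbsGal k) (GeomPoints E)

/-! ### Principal homogeneous spaces -/

/-- A principal homogeneous space for `E` over `k`: a nonempty smooth proper `k`-scheme `C`
with an action `E × C ⟶ C` over `k` which is simply transitive, that is, such that
`E × C ⟶ C × C`, `(e, c) ↦ (e • c, c)`, is an isomorphism. (It follows that `C` becomes isomorphic
to `E` over `k̄`, so that `C` is a geometrically integral curve.) -/
structure PrincipalHomogeneousSpace {k : Type u} [Field k] (E : Over (Spec (.of k)))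
    [GrpObj E] where
  /-- the underlying curve -/
  C : Over (Spec (.of k))
  /-- the action of `E` -/
  [act : ModObj E C]
  [isProper : IsProper C.hom]
  [smooth : Smooth C.hom]
  [nonempty : Nonempty C.left]
  [simplyTransitive : IsIso (ModObj.leftSMul E C)]

namespace PrincipalHomogeneousSpace

attribute [instance] act isProper smooth nonempty simplyTransitive

/-- A principal homogeneous space is trivial if it is isomorphic, as a principal homogeneous
space, to `E` acting on itself by translations. -/
def IsTrivial {k : Type u} [Field k] {E : Over (Spec (.of k))} [GrpObj E]
    (X : PrincipalHomogeneousSpace E) : Prop :=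
  letI : ModObj E E := ModObj.regular E
  ∃ e : X.C ≅ E, IsModHom E e.hom

variable {k : Type u} [Field k] {E : Over (Spec (.of k))} [GrpObj E]

/-- For `P, Q ∈ C(k̄)`, the unique `e ∈ E(k̄)` with `e • P = Q`. -/
def diff (X : PrincipalHomogeneousSpace E) (P Q : GeomPoints X.C) : GeomPoints E :=
  (ModObj.isIso_leftSMul_iff.mp X.simplyTransitive _ P Q).choose

lemma diff_smul (X : PrincipalHomogeneousSpace E) (P Q : GeomPoints X.C) :
    X.diff P Q • P = Q :=
  (ModObj.isIso_leftSMul_iff.mp X.simplyTransitive _ P Q).choose_spec.1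

lemma eq_diff (X : PrincipalHomogeneousSpace E) {P Q : GeomPoints X.C} {e : GeomPoints E}
    (h : e • P = Q) : e = X.diff P Q :=
  (ModObj.isIso_leftSMul_iff.mp X.simplyTransitive _ P Q).unique h (X.diff_smul P Q)

lemma gal_smul_smul (X : PrincipalHomogeneousSpace E) (σ : AbsGal k) (e : GeomPoints E)
    (P : GeomPoints X.C) : σ • (e • P) = (σ • e) • (σ • P) :=
  ModObj.comp_smul (galAut σ) e P

variable [IsEllipticCurve E]

/-- The continuous cocycle `σ ↦ σ(P) - P` attached to a geometric point `P` of `C`. -/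
def cocycle (X : PrincipalHomogeneousSpace E) (P : GeomPoints X.C) :
    contCocycles (AbsGal k) (GeomPoints E) :=
  ⟨fun σ => X.diff P (σ • P), by
    have hc : groupCohomology.IsMulCocycle₁ (fun σ : AbsGal k => X.diff P (σ • P)) := by
      intro σ τ
      refine (X.eq_diff ?_).symm
      rw [mul_smul, diff_smul, ← gal_smul_smul, diff_smul, mul_smul]
    refine ⟨?_, hc⟩
    obtain ⟨U, hU, hUP⟩ := exists_open_stabilizer P
    rw [IsLocallyConstant.iff_exists_open]
    intro σ
    refine ⟨(fun τ => σ * τ) '' (U : Set (AbsGal k)), isOpenMap_mul_left σ _ hU,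
      ⟨1, U.one_mem, mul_one σ⟩, ?_⟩
    rintro _ ⟨τ, hτ, rfl⟩
    change X.diff P ((σ * τ) • P) = X.diff P (σ • P)
    rw [mul_smul, hUP τ hτ]⟩

/-- The class `[C] ∈ WC(E/k)`, computed from any geometric point of `C`. -/
def wcClass (X : PrincipalHomogeneousSpace E) : WeilChatelet E :=
  QuotientGroup.mk (X.cocycle (nonempty_geomPoints X.C).some)

/-- The class does not depend on the geometric point. -/
lemma wcClass_eq (X : PrincipalHomogeneousSpace E) (P : GeomPoints X.C) :
    X.wcClass = QuotientGroup.mk (X.cocycle P) := by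
  refine (QuotientGroup.eq).mpr ?_
  set Q := (nonempty_geomPoints X.C).some
  refine ⟨X.diff Q P, fun σ => ?_⟩
  change _ = (X.diff Q (σ • Q))⁻¹ * X.diff P (σ • P)
  have h : X.diff P (σ • P) * X.diff Q P = (σ • X.diff Q P) * X.diff Q (σ • Q) := by
    refine (X.eq_diff (P := Q) (Q := σ • P) ?_).trans (X.eq_diff ?_).symm
    · rw [mul_smul, diff_smul, diff_smul]
    · rw [mul_smul, diff_smul, ← gal_smul_smul, diff_smul]
  rw [div_eq_iff_eq_mul, mul_assoc, h, mul_comm, mul_assoc, mul_inv_cancel, mul_one]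

/-- The period of a principal homogeneous space: the order of its class in `WC(E/k)`. -/
def period (X : PrincipalHomogeneousSpace E) : ℕ := orderOf X.wcClass

end PrincipalHomogeneousSpace

end

/-! Since the `n`-th roots of unity lie in `k`, the full level structure makes Galois act trivially
on the geometric points of `E[n]`, hence through the quadratic character of `L/k` on those of
`E'[n]`; call this module `M`. Everything reduces to H¹(k, M) = 0. Indeed `E'(k̄)` is `n`-divisible
(`IsEllipticCurve.exists_pow_eq`), so a class killed by `n` comes from `M`
(`PrincipalHomogeneousSpace.exists_cocycle_pow_eq_one`), and a space with trivial class has a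
rational point, hence is trivial (`isTrivial_of_wcClass_eq_one`).

For the vanishing (`isMulCoboundary₁_of_quadratic_twist`), a cocycle restricts on the Galois group
of `L` to a homomorphism that conjugation by an element τ outside this group inverts. Composed with
a character of `M`, it is h ↦ h(b)/b by Kummer theory, with bⁿ in `L`, and τ(b) belongs to the
inverse character. But τ acts trivially on `n`-th power classes of `L`, so b and τ(b) belong to the
same character; its square is 1, and it is trivial because `n` is odd. What is left is a class on a
group of order two, which dies because 2 is invertible on `M`.

The arithmetic input is that y = σx/x is an `n`-th power in `L`
(`IsUltrametricDist.exists_pow_eq_involution_div`). Here y is a unit with y·σ(y) = 1. As `p` does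
not divide `n`, principal units are `n`-th powers, so only the residue of y matters. The obstruction
is an `n`-th root of unity, which σ fixes; so its square is 1, and it is 1 because `n` is odd. -/

/-! ### Powers in nonarchimedean local fields -/

/-- In a finite cyclic group of order `N`, an element killed by `N / gcd(n, N)` is an `n`-th
power. -/
lemma IsCyclic.exists_pow_eq_of_pow_card_div_gcd {G : Type*} [Group G] [Finite G] [IsCyclic G]
    {n : ℕ} {w : G} (hw : w ^ (Nat.card G / n.gcd (Nat.card G)) = 1) : ∃ v : G, v ^ n = w := by
  obtain ⟨g, hg⟩ := IsCyclic.exists_generator (α := G)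
  obtain ⟨j, rfl⟩ := Subgroup.mem_zpowers_iff.mp (hg w)
  have hcard : 0 < Nat.card G := Nat.card_pos
  have horder : orderOf g = Nat.card G := orderOf_eq_card_of_forall_mem_zpowers hg
  set d := n.gcd (Nat.card G) with hd
  have hdpos : 0 < d := Nat.gcd_pos_of_pos_right _ hcard
  obtain ⟨e, he⟩ : d ∣ Nat.card G := Nat.gcd_dvd_right _ _
  have hepos : 0 < e := Nat.pos_of_mul_pos_left (he ▸ hcard)
  rw [he, Nat.mul_div_cancel_left _ hdpos, ← zpow_natCast, ← zpow_mul,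
    ← orderOf_dvd_iff_zpow_eq_one, horder, he] at hw
  push_cast at hw
  obtain ⟨i, rfl⟩ : (d : ℤ) ∣ j :=
    Int.dvd_of_mul_dvd_mul_right (by exact_mod_cast hepos.ne') hw
  -- With w = g^(d·i), Bézout writes d as a multiple of n plus a multiple of the group order; the
  -- latter contributes nothing.
  refine ⟨g ^ (n.gcdA (Nat.card G) * i), ?_⟩
  have hcardpow : g ^ ((Nat.card G : ℤ) * (n.gcdB (Nat.card G) * i)) = 1 := by
    rw [zpow_mul, zpow_natCast, pow_card_eq_one', one_zpow]
  have hbez := Nat.gcd_eq_gcd_ab n (Nat.card G)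
  rw [← hd] at hbez
  rw [← zpow_natCast, ← zpow_mul, hbez, add_mul, zpow_add, mul_assoc (Nat.card G : ℤ), hcardpow,
    mul_one]
  congr 1
  ring

section Ultrametric

variable {F : Type*} [NormedField F] [IsUltrametricDist F]

lemma IsUltrametricDist.norm_pow_sub_one_le {w : F} (m : ℕ) (hw : ‖w‖ = 1) :
    ‖w ^ m - 1‖ ≤ ‖w - 1‖ := by
  rw [← geom_sum_mul, norm_mul]
  refine mul_le_of_le_one_left (norm_nonneg _)
    (IsUltrametricDist.norm_sum_le_of_forall_le_of_nonneg zero_le_one fun i _ => ?_)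
  rw [norm_pow, hw, one_pow]

/-- Raising to the `p`-th power contracts towards 1: in the expansion of (1 + t)^p the middle terms
carry a factor `p`, and the last one carries t² because `p` ≥ 2. -/
lemma IsUltrametricDist.norm_pow_prime_sub_one_le {p : ℕ} (hp : p.Prime) {u : F}
    (hu : ‖u - 1‖ < 1) : ‖u ^ p - 1‖ ≤ max ‖u - 1‖ ‖(p : F)‖ * ‖u - 1‖ := by
  set t := u - 1 with ht
  have hut : u = t + 1 := by rw [ht]; ring
  have key : u ^ p - 1 = ∑ m ∈ Finset.Ico 1 (p + 1), t ^ m * (p.choose m : F) := by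
    rw [hut, add_pow, Finset.range_eq_Ico, Finset.sum_eq_sum_Ico_succ_bot (by omega)]
    simp
  rw [key]
  refine IsUltrametricDist.norm_sum_le_of_forall_le_of_nonneg (by positivity) fun m hm => ?_
  rw [Finset.mem_Ico] at hm
  rcases (show m = p ∨ m < p by omega) with rfl | hmp
  · obtain ⟨j, rfl⟩ : ∃ j, m = j + 2 := ⟨m - 2, by have := hp.two_le; omega⟩
    rw [Nat.choose_self, Nat.cast_one, mul_one, norm_pow, pow_succ, pow_succ]
    gcongr
    refine le_trans ?_ (le_max_left _ _)
    exact mul_le_of_le_one_left (norm_nonneg _) (pow_le_one₀ (norm_nonneg _) hu.le)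
  · obtain ⟨c, hc⟩ := hp.dvd_choose_self (by omega) hmp
    obtain ⟨j, rfl⟩ : ∃ j, m = j + 1 := ⟨m - 1, by omega⟩
    rw [hc, Nat.cast_mul, norm_mul, norm_mul, norm_pow, pow_succ]
    have h1 : ‖t‖ ^ j ≤ 1 := pow_le_one₀ (norm_nonneg _) hu.le
    have h2 : ‖(c : F)‖ ≤ 1 := IsUltrametricDist.norm_natCast_le_one F c
    calc ‖t‖ ^ j * ‖t‖ * (‖(p : F)‖ * ‖(c : F)‖)
        = (‖t‖ ^ j * ‖(c : F)‖) * (‖(p : F)‖ * ‖t‖) := by ring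
      _ ≤ 1 * (‖(p : F)‖ * ‖t‖) := by
          gcongr; exact mul_le_one₀ h1 (norm_nonneg _) h2
      _ ≤ _ := by rw [one_mul]; gcongr; exact le_max_right _ _

-- The contraction is iterated with the constant c of the first step, which stays valid because the
-- distance to 1 only decreases.
open Filter Topology in
lemma IsUltrametricDist.tendsto_pow_prime_pow {p : ℕ} (hp : p.Prime) (hpF : ‖(p : F)‖ < 1) {u : F}
    (hu : ‖u - 1‖ < 1) : Tendsto (fun j : ℕ => u ^ p ^ j) atTop (𝓝 1) := by
  set c := max ‖u - 1‖ ‖(p : F)‖ with hc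
  have hc0 : 0 ≤ c := le_max_of_le_left (norm_nonneg _)
  have hc1 : c < 1 := max_lt hu hpF
  have h : ∀ j : ℕ, ‖u ^ p ^ j - 1‖ ≤ c ^ j * ‖u - 1‖ := by
    intro j
    induction j with
    | zero => simp
    | succ j ih =>
      have hle : ‖u ^ p ^ j - 1‖ ≤ ‖u - 1‖ :=
        ih.trans (mul_le_of_le_one_left (norm_nonneg _) (pow_le_one₀ hc0 hc1.le))
      rw [pow_succ, pow_mul]
      refine (norm_pow_prime_sub_one_le hp (hle.trans_lt hu)).trans ?_
      calc max ‖u ^ p ^ j - 1‖ ‖(p : F)‖ * ‖u ^ p ^ j - 1‖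
          ≤ c * (c ^ j * ‖u - 1‖) := by
            gcongr; exact max_le_max_right _ hle
        _ = c ^ (j + 1) * ‖u - 1‖ := by ring
  rw [tendsto_iff_norm_sub_tendsto_zero]
  refine squeeze_zero (fun _ => norm_nonneg _) h ?_
  simpa using (tendsto_pow_atTop_nhds_zero_of_lt_one hc0 hc1).mul_const ‖u - 1‖

open Filter Topology in
/-- In a locally compact nonarchimedean field of residue characteristic `p`, the principal units
are `n`-th powers for every `n` prime to `p`. -/
lemma IsUltrametricDist.exists_pow_eq_of_norm_sub_one_lt [ProperSpace F] {p : ℕ} (hp : p.Prime)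
    (hpF : ‖(p : F)‖ < 1) {n : ℕ} (hpn : n.Coprime p) {u : F} (hu : ‖u - 1‖ < 1) :
    ∃ v : F, v ^ n = u := by
  have hu1 : ‖u‖ = 1 := by
    have := IsUltrametricDist.norm_add_eq_max_of_norm_ne_norm (x := u - 1) (y := (1 : F))
      (by rw [norm_one]; exact hu.ne)
    rw [sub_add_cancel, norm_one, max_eq_right hu.le] at this
    exact this
  -- Compactness takes the place of Hensel's lemma: the `n`-th powers of norm-one elements form a
  -- closed set, and u is a limit of u^(n·a) with n·a ≡ 1 modulo growing powers of `p`.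
  have hclosed : IsClosed ((fun v : F => v ^ n) '' Metric.sphere 0 1) :=
    ((isCompact_sphere 0 1).image (continuous_pow n)).isClosed
  suffices h : u ∈ (fun v : F => v ^ n) '' Metric.sphere 0 1 by
    obtain ⟨v, -, hv⟩ := h
    exact ⟨v, hv⟩
  -- The exponent j + 1 keeps the modulus larger than 1.
  have hnat : ∀ j : ℕ, ∃ a b : ℕ, n * a = p ^ (j + 1) * b + 1 := by
    intro j
    obtain ⟨m, -, hm⟩ := Nat.exists_mul_mod_eq_one_of_coprime (hpn.pow_right (j + 1))
      (Nat.one_lt_pow j.succ_ne_zero hp.one_lt)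
    exact ⟨m, n * m / p ^ (j + 1), by
      conv_lhs => rw [← Nat.div_add_mod (n * m) (p ^ (j + 1)), hm]⟩
  choose a b hab using hnat
  have hlim : Tendsto (fun j : ℕ => u ^ (n * a j)) atTop (𝓝 u) := by
    rw [tendsto_iff_norm_sub_tendsto_zero]
    have hto := (tendsto_iff_norm_sub_tendsto_zero.mp (tendsto_pow_prime_pow hp hpF hu)).comp
      (tendsto_add_atTop_nat 1)
    refine squeeze_zero (fun _ => norm_nonneg _) (fun j => ?_) hto
    rw [hab, pow_succ, pow_mul, ← sub_one_mul, norm_mul, hu1, mul_one]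
    exact norm_pow_sub_one_le _ (by rw [norm_pow, hu1, one_pow])
  refine hclosed.mem_of_tendsto hlim (Eventually.of_forall fun j => ⟨u ^ a j, ?_, ?_⟩)
  · simp [hu1]
  · change (u ^ a j) ^ n = _
    rw [← pow_mul, mul_comm]

end Ultrametric

open scoped Valued NormedField in
/-- In a locally compact nonarchimedean field of residue characteristic prime to `n`, being an
`n`-th power among the elements of norm one is detected by a power `y ^ e` modulo the principal
units, and this power is an `n`-th root of unity modulo the principal units. -/
lemma IsUltrametricDist.exists_exponent_pow_eq {F : Type*} [NontriviallyNormedField F]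
    [IsUltrametricDist F] [ProperSpace F] {p : ℕ} (hp : p.Prime) (hpF : ‖(p : F)‖ < 1) {n : ℕ} (hpn : n.Coprime p) :
    ∃ e : ℕ, (∀ y : F, ‖y‖ = 1 → ‖(y ^ e) ^ n - 1‖ < 1) ∧
      ∀ y : F, ‖y‖ = 1 → ‖y ^ e - 1‖ < 1 → ∃ v : F, v ^ n = y := by
  have hcomp : CompactSpace 𝒪[F] := by
    rw [← isCompact_univ_iff, Subtype.isCompact_iff, Set.image_univ, Subtype.range_coe_subtype]
    convert isCompact_closedBall (0 : F) 1 using 1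
    ext x
    simp [Valued.integer.mem_iff]
  have : (Valued.v : Valuation F _).RankOne :=
    inferInstanceAs (Valuation.RankOne (NormedField.valuation (K := F)))
  have hfin : Finite 𝓀[F] :=
    (Valued.integer.compactSpace_iff_completeSpace_and_isDiscreteValuationRing_and_finite_residueField.mp
      hcomp).2.2
  have hres : ∀ x : 𝒪[F], IsLocalRing.residue 𝒪[F] x = 0 ↔ ‖(x : F)‖ < 1 := fun x => by
    rw [IsLocalRing.residue_eq_zero_iff, IsLocalRing.mem_maximalIdeal, mem_nonunits_iff,
      Valued.integer.isUnit_iff_norm_eq_one]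
    exact ⟨fun h => lt_of_le_of_ne (Valued.integer.norm_le_one x) h, fun h => h.ne⟩
  have hunit : ∀ y : F, ‖y‖ = 1 → ∃ Y : 𝒪[F]ˣ, ((Y : 𝒪[F]) : F) = y := fun y hy =>
    ⟨(Valued.integer.isUnit_iff_norm_eq_one (u := ⟨y, Valued.integer.mem_iff.mpr hy.le⟩).mpr
      hy).unit, rfl⟩
  let R : 𝒪[F]ˣ →* 𝓀[F]ˣ := Units.map (IsLocalRing.residue 𝒪[F])
  have hR : ∀ Y : 𝒪[F]ˣ, R Y = 1 ↔ ‖((Y : 𝒪[F]) : F) - 1‖ < 1 := fun Y => by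
    have := hres (Y - 1)
    rw [map_sub, map_one, sub_eq_zero] at this
    rw [Units.ext_iff]
    exact this
  set N := Nat.card 𝓀[F]ˣ
  -- The residue units form a cyclic group of order N, whose `n`-th powers are exactly the elements
  -- killed by this exponent.
  refine ⟨N / n.gcd N, fun y hy => ?_, fun y hy hye => ?_⟩
  · obtain ⟨Y, rfl⟩ := hunit y hy
    have h1 : R ((Y ^ (N / n.gcd N)) ^ n) = 1 := by
      obtain ⟨m, hm⟩ := Nat.gcd_dvd_left n N
      rw [map_pow, map_pow, ← pow_mul]
      conv_lhs => rw [hm, ← mul_assoc, ← hm, Nat.div_mul_cancel (Nat.gcd_dvd_right n N), pow_mul]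
      rw [pow_card_eq_one', one_pow]
    simpa using (hR _).mp h1
  · obtain ⟨Y, rfl⟩ := hunit y hy
    have h1 : (R Y) ^ (N / n.gcd N) = 1 := by
      rw [← map_pow, hR]
      simpa using hye
    obtain ⟨V, hV⟩ := IsCyclic.exists_pow_eq_of_pow_card_div_gcd h1
    -- Lift the residual root to a unit W; then Y/Wⁿ is a principal unit, hence an `n`-th power.
    obtain ⟨W, rfl⟩ := IsLocalRing.surjective_units_map_of_local_ringHom
      (IsLocalRing.residue 𝒪[F]) IsLocalRing.residue_surjective inferInstance V
    have h2 : R (Y * (W ^ n)⁻¹) = 1 := by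
      rw [map_mul, map_inv, map_pow, mul_inv_eq_one]
      exact hV.symm
    obtain ⟨v, hv⟩ := exists_pow_eq_of_norm_sub_one_lt hp hpF hpn ((hR _).mp h2)
    refine ⟨v * ((W : 𝒪[F]) : F), ?_⟩
    rw [mul_pow, hv]
    have h3 : (Y * (W ^ n)⁻¹) * W ^ n = Y := inv_mul_cancel_right _ _
    have h4 := congrArg (fun Z : 𝒪[F]ˣ => ((Z : 𝒪[F]) : F)) h3
    exact h4

/-- If `σ` is an isometric involution of a nonarchimedean local field of residue characteristic
prime to the odd number `n`, fixing a primitive `n`-th root of unity, then `σ x / x` is an `n`-th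
power for every `x ≠ 0`. -/
lemma IsUltrametricDist.exists_pow_eq_involution_div {F : Type*} [NontriviallyNormedField F]
    [IsUltrametricDist F] [ProperSpace F] {p : ℕ} (hp : p.Prime) (hpF : ‖(p : F)‖ < 1) {n : ℕ}
    (hpn : n.Coprime p) (hodd : Odd n) (σ : F ≃+* F) (hσ : ∀ x, σ (σ x) = x)
    (hnorm : ∀ x, ‖σ x‖ = ‖x‖) {ζ : F} (hζ : IsPrimitiveRoot ζ n) (hσζ : σ ζ = ζ) {x : F}
    (hx : x ≠ 0) : ∃ v : F, v ^ n = σ x / x := by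
  have hnpos : 0 < n := hodd.pos
  obtain ⟨e, he1, he2⟩ := exists_exponent_pow_eq (F := F) hp hpF hpn
  set y := σ x / x with hy
  have hσx : σ x ≠ 0 := (map_ne_zero σ).mpr hx
  have hy1 : ‖y‖ = 1 := by rw [hy, norm_div, hnorm, div_self (norm_ne_zero_iff.mpr hx)]
  have hyσ : y * σ y = 1 := by rw [hy, map_div₀, hσ]; field_simp
  refine he2 y hy1 ?_
  set a := y ^ e with ha
  have ha1 : ‖a‖ = 1 := by rw [ha, norm_pow, hy1, one_pow]
  have haσ : a * σ a = 1 := by rw [ha, map_pow, ← mul_pow, hyσ, one_pow]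
  -- A product of norm less than 1 has a factor of norm less than 1, so a is close to a genuine root
  -- of unity z, which σ fixes.
  have hprod : a ^ n - 1 = ∏ z ∈ Polynomial.nthRootsFinset n (1 : F), (a - z) := by
    have := congrArg (Polynomial.eval a) (Polynomial.X_pow_sub_one_eq_prod hnpos hζ)
    simpa [Polynomial.eval_prod] using this
  obtain ⟨z, hz, haz⟩ : ∃ z ∈ Polynomial.nthRootsFinset n (1 : F), ‖a - z‖ < 1 := by
    by_contra! hcon
    have h1 := he1 y hy1
    rw [← ha, hprod, norm_prod] at h1
    refine h1.not_ge ?_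
    calc (1 : ℝ) = ∏ z ∈ Polynomial.nthRootsFinset n (1 : F), 1 := by simp
      _ ≤ _ := Finset.prod_le_prod (fun _ _ => zero_le_one) hcon
  have hzn : z ^ n = 1 := (Polynomial.mem_nthRootsFinset hnpos 1).mp hz
  have hz1 : ‖z‖ = 1 := by
    have := congrArg norm hzn
    rw [norm_pow, norm_one] at this
    exact (pow_eq_one_iff_of_nonneg (norm_nonneg _) hnpos.ne').mp this
  have hσz : σ z = z := by
    have : NeZero n := ⟨hnpos.ne'⟩
    obtain ⟨i, -, rfl⟩ := hζ.eq_pow_of_pow_eq_one hzn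
    rw [map_pow, hσζ]
  have haz' : ‖σ a - z‖ < 1 := by rw [← hσz, ← map_sub, hnorm]; exact haz
  -- Both a and σ(a) are close to z, while their product is 1.
  have hz2 : ‖z ^ 2 - 1‖ < 1 := by
    rw [norm_sub_rev, show 1 - z ^ 2 = (a - z) * σ a + z * (σ a - z) by linear_combination -haσ]
    refine (IsUltrametricDist.norm_add_le_max _ _).trans_lt (max_lt ?_ ?_)
    · rwa [norm_mul, hnorm, ha1, mul_one]
    · rwa [norm_mul, hz1, one_mul]
  -- Oddness makes z a power of z²: z = z^(n+1).
  have hzone : ‖z - 1‖ < 1 := by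
    obtain ⟨m, hm⟩ := hodd
    have h1 : z = (z ^ 2) ^ (m + 1) := by
      rw [← pow_mul, show 2 * (m + 1) = n + 1 by omega, pow_succ, hzn, one_mul]
    rw [h1]
    exact (norm_pow_sub_one_le _ (by rw [norm_pow, hz1, one_pow])).trans_lt hz2
  rw [← sub_add_sub_cancel a z 1]
  exact (IsUltrametricDist.norm_add_le_max _ _).trans_lt (max_lt haz hzone)

/-- Let `L` be a finite extension of `ℚ_p`, `n` odd and prime to `p`, and `σ` an involution of `L`
fixing a primitive `n`-th root of unity. Then `σ x / x` is an `n`-th power for all `x ≠ 0`. -/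
lemma exists_pow_eq_involution_div_of_padic (p : ℕ) [Fact p.Prime] (L : Type*) [Field L]
    [Algebra ℚ_[p] L] [FiniteDimensional ℚ_[p] L] {n : ℕ} (hpn : ¬ p ∣ n) (hodd : Odd n)
    (σ : L ≃ₐ[ℚ_[p]] L) (hσ : ∀ x, σ (σ x) = x) {ζ : L} (hζ : IsPrimitiveRoot ζ n)
    (hσζ : σ ζ = ζ) {x : L} (hx : x ≠ 0) : ∃ v : L, v ^ n = σ x / x := by
  have hp : p.Prime := Fact.out
  -- The spectral norm is invariant under automorphisms over `ℚ_[p]`, so σ is an isometry for it.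
  let : NontriviallyNormedField L := spectralNorm.nontriviallyNormedField ℚ_[p] L
  let : NormedSpace ℚ_[p] L := spectralNorm.normedSpace ℚ_[p] L
  have : ProperSpace L := FiniteDimensional.proper ℚ_[p] L
  have : IsUltrametricDist L :=
    IsUltrametricDist.isUltrametricDist_of_isNonarchimedean_norm
      (isNonarchimedean_spectralNorm (K := ℚ_[p]) (L := L))
  have hpL : ‖(p : L)‖ < 1 := by
    have : ‖algebraMap ℚ_[p] L p‖ = ‖(p : ℚ_[p])‖ := spectralNorm_extends (p : ℚ_[p])
    rw [map_natCast] at this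
    rw [this]
    exact Padic.norm_p_lt_one
  exact IsUltrametricDist.exists_pow_eq_involution_div hp hpL
    ((Nat.Prime.coprime_iff_not_dvd hp).mpr hpn).symm hodd σ.toRingEquiv hσ
    (fun y => (spectralNorm_eq_of_equiv σ y).symm) hζ hσζ hx

/-! ### Kummer theory and cohomology of quadratic twists of trivial modules -/

/-- Kummer theory: a character with open kernel and finite image of a subgroup `H` of a Galois
group, with values in the base field, is of the form `h ↦ h(b) / b`. -/
lemma exists_kummer_generator {K Ω : Type*} [Field K] [Field Ω] [Algebra K Ω] [IsGalois K Ω]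
    (H : Subgroup Gal(Ω/K)) (f : H →* Kˣ) [Finite f.range]
    (hf : IsOpen ((f.ker.map H.subtype : Subgroup Gal(Ω/K)) : Set Gal(Ω/K))) :
    ∃ b : Ω, b ≠ 0 ∧ ∀ h : H, (h : Gal(Ω/K)) b = algebraMap K Ω (f h) * b := by
  classical
  have := Fintype.ofFinite f.range
  set N := f.ker.map H.subtype
  set F := IntermediateField.fixedField N
  have hfix : F.fixingSubgroup = N :=
    InfiniteGalois.fixingSubgroup_fixedField (k := K) (K := Ω) ⟨N, Subgroup.isClosed_of_isOpen N hf⟩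
  -- One lift per value of f suffices: on the fixed field F of the kernel, the action of h depends
  -- only on f(h).
  choose r hr using fun v : f.range => v.2
  have hsame : ∀ (g h : H), f g = f h → ∀ z : F, (g : Gal(Ω/K)) z = (h : Gal(Ω/K)) z := by
    intro g h hgh z
    have h1 : ((h⁻¹ * g : H) : Gal(Ω/K)) ∈ N :=
      ⟨h⁻¹ * g, by rw [SetLike.mem_coe, MonoidHom.mem_ker, map_mul, map_inv, hgh, inv_mul_cancel], rfl⟩
    have h2 : ((h⁻¹ * g : H) : Gal(Ω/K)) (z : Ω) = z := z.2 ⟨_, h1⟩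
    have h3 := congrArg (h : Gal(Ω/K)) h2
    rw [← h3, ← AlgEquiv.mul_apply]
    simp
  let χ : f.range → (F →* Ω) := fun v =>
    ((r v : Gal(Ω/K)) : Ω →* Ω).comp (algebraMap F Ω : F →* Ω)
  have hχ : Function.Injective χ := by
    intro v w hvw
    have h1 : ((r w)⁻¹ * r v : Gal(Ω/K)) ∈ N := by
      rw [← hfix, IntermediateField.mem_fixingSubgroup_iff]
      intro z hz
      have h2 : (r v : Gal(Ω/K)) z = (r w : Gal(Ω/K)) z := DFunLike.congr_fun hvw ⟨z, hz⟩
      rw [AlgEquiv.mul_apply, h2, ← AlgEquiv.mul_apply]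
      simp
    obtain ⟨g, hg, hg'⟩ := h1
    have h2 : g = (r w)⁻¹ * r v := Subtype.ext hg'
    rw [SetLike.mem_coe, MonoidHom.mem_ker, h2, map_mul, map_inv, inv_mul_eq_one, hr, hr] at hg
    exact Subtype.ext hg.symm
  have hli : LinearIndependent Ω (fun v => (χ v : F → Ω)) :=
    (linearIndependent_monoidHom F Ω).comp χ hχ
  -- The generator is a Lagrange resolvent, nonzero at some z by independence of characters.
  -- Applying h permutes its terms by v ↦ f(h)·v, which pulls out the factor f(h).
  have hne : ∑ v : f.range, algebraMap K Ω ((v : Kˣ)⁻¹ : Kˣ) • (χ v : F → Ω) ≠ 0 := by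
    intro h0
    have := Fintype.linearIndependent_iff.mp hli _ h0 1
    simp at this
  obtain ⟨z, hz⟩ := Function.ne_iff.mp hne
  rw [Finset.sum_apply] at hz
  refine ⟨_, hz, fun h => ?_⟩
  rw [map_sum, Finset.mul_sum]
  refine Fintype.sum_equiv (Equiv.mulLeft (⟨f h, h, rfl⟩ : f.range)) _ _ fun v => ?_
  have h1 : (h : Gal(Ω/K)) ((r v : Gal(Ω/K)) z) =
      (r (⟨f h, h, rfl⟩ * v : f.range) : Gal(Ω/K)) z := by
    refine hsame (h * r v) _ ?_ z
    rw [map_mul, hr, hr]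
    rfl
  change (h : Gal(Ω/K)) (algebraMap K Ω _ * (r v : Gal(Ω/K)) z) =
    algebraMap K Ω (f h) * (algebraMap K Ω _ * (r (⟨f h, h, rfl⟩ * v : f.range) : Gal(Ω/K)) z)
  rw [map_mul, AlgEquiv.commutes, h1, ← mul_assoc, ← map_mul]
  congr 2
  simp only [Equiv.coe_mulLeft, Subgroup.coe_mul, mul_inv_rev, Units.val_mul]
  rw [mul_left_comm, Units.mul_inv, mul_one]

/-- Let `n` be odd, `K` contain the `n`-th roots of unity, and let `M` be a finite module killed
by `n` on which a subgroup `H` of index two of the Galois group acts trivially and its complement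
acts by inversion. If the complement of `H` acts trivially on the `n`-th power classes of the fixed
field of `H`, then every continuous cocycle with values in `M` is a coboundary. -/
lemma isMulCoboundary₁_of_quadratic_twist {K Ω : Type*} [Field K] [Field Ω] [Algebra K Ω]
    [IsGalois K Ω] {n : ℕ} (hodd : Odd n) {ζ : K} (hζ : IsPrimitiveRoot ζ n)
    (H : Subgroup Gal(Ω/K)) (hHo : IsOpen (H : Set Gal(Ω/K)))
    {τ : Gal(Ω/K)} (hτ : τ ∉ H) (hH : ∀ g, g ∉ H → τ⁻¹ * g ∈ H)
    (hpow : ∀ x : Ω, x ≠ 0 → (∀ h ∈ H, h x = x) → ∃ d : Ω, (∀ h ∈ H, h d = d) ∧ d ^ n = τ x / x)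
    {M : Type*} [CommGroup M] [Finite M] [MulDistribMulAction Gal(Ω/K) M]
    (hM : ∀ m : M, m ^ n = 1) (htriv : ∀ h ∈ H, ∀ m : M, h • m = m)
    (hinv : ∀ g ∉ H, ∀ m : M, g • m = m⁻¹)
    (z : Gal(Ω/K) → M) (hz : IsLocallyConstant z) (hzc : groupCohomology.IsMulCocycle₁ z) :
    groupCohomology.IsMulCoboundary₁ z := by
  have hnpos : 0 < n := hodd.pos
  have : NeZero n := ⟨hnpos.ne'⟩
  obtain ⟨m₀, hm₀⟩ := hodd
  have hHn : ∀ h ∈ H, τ⁻¹ * h * τ ∈ H := by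
    intro h hh
    by_contra hcon
    have h1 := hH _ (fun h2 : h * τ ∈ H => hτ ((H.mul_mem_cancel_left hh).mp h2))
    rw [← mul_assoc] at h1
    exact hcon h1
  have hzmul : ∀ h ∈ H, ∀ g, z (h * g) = z g * z h := fun h hh g => by rw [hzc, htriv h hh]
  -- Expand z(hτ) in two ways, using hτ = τ·(τ⁻¹hτ).
  have hzconj : ∀ h ∈ H, z (τ⁻¹ * h * τ) = (z h)⁻¹ := by
    intro h hh
    have h1 := hzmul h hh τ
    have h2 := hzc τ (τ⁻¹ * h * τ)
    rw [hinv τ hτ, mul_assoc, mul_inv_cancel_left, h1, mul_comm, mul_left_inj] at h2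
    rw [h2, inv_inv, mul_assoc]
  -- Characters of `M` with values in `K` separate its elements, so it is enough to kill each
  -- composite with z.
  have hzH : ∀ h ∈ H, z h = 1 := by
    have hexp : Monoid.exponent M ∣ n := Monoid.exponent_dvd_of_forall_pow_eq_one hM
    have : HasEnoughRootsOfUnity K n := ⟨⟨ζ, hζ⟩, inferInstance⟩
    have : HasEnoughRootsOfUnity K (Monoid.exponent M) := HasEnoughRootsOfUnity.of_dvd K hexp
    intro h₀ hh₀
    by_contra hne
    obtain ⟨ψ, hψ⟩ := CommGroup.exists_apply_ne_one_of_hasEnoughRootsOfUnity M K hne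
    let f : H →* Kˣ :=
      { toFun := fun h => ψ (z h)
        map_one' := by
          have := hzmul 1 H.one_mem 1
          rw [mul_one, left_eq_mul] at this
          rw [OneMemClass.coe_one, this, map_one]
        map_mul' := fun g h => by
          rw [Subgroup.coe_mul, hzmul g g.2, map_mul, mul_comm] }
    have hfin : Finite f.range := by
      refine Set.Finite.subset (Set.finite_range ψ) ?_
      rintro _ ⟨h, rfl⟩
      exact ⟨z h, rfl⟩
    have hopen : IsOpen ((f.ker.map H.subtype : Subgroup Gal(Ω/K)) : Set Gal(Ω/K)) := by
      have : ((f.ker.map H.subtype : Subgroup Gal(Ω/K)) : Set Gal(Ω/K)) =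
          (H : Set Gal(Ω/K)) ∩ z ⁻¹' {m | ψ m = 1} := by
        ext g
        constructor
        · rintro ⟨h, hh, rfl⟩
          exact ⟨h.2, hh⟩
        · rintro ⟨hg, hg'⟩
          exact ⟨⟨g, hg⟩, hg', rfl⟩
      rw [this]
      exact hHo.inter (hz _)
    obtain ⟨b, hb0, hb⟩ := exists_kummer_generator H f hopen
    have hfn : ∀ h, (f h) ^ n = 1 := fun h => by
      change ψ _ ^ n = 1
      rw [← map_pow, hM, map_one]
    have hτb0 : τ b ≠ 0 := (map_ne_zero τ).mpr hb0
    have hτb : ∀ h : H, (h : Gal(Ω/K)) (τ b) = algebraMap K Ω ((f h)⁻¹ : Kˣ) * τ b := by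
      intro h
      have h1 := congrArg τ (hb ⟨_, hHn h h.2⟩)
      rw [map_mul, AlgEquiv.commutes, ← AlgEquiv.mul_apply] at h1
      have h2 : f ⟨_, hHn h h.2⟩ = (f h)⁻¹ := by
        change ψ _ = (ψ _)⁻¹
        rw [hzconj h h.2, map_inv]
      rw [h2] at h1
      rw [← h1, ← AlgEquiv.mul_apply]
      congr 1
      group
    obtain ⟨d, hd, hdn⟩ := hpow (b ^ n) (pow_ne_zero _ hb0) (fun h hh => by
      rw [map_pow, hb ⟨h, hh⟩, mul_pow, ← map_pow, ← Units.val_pow_eq_pow_val, hfn,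
        Units.val_one, map_one, one_mul])
    rw [map_pow] at hdn
    have hd0 : d ≠ 0 := by
      rintro rfl
      rw [zero_pow hnpos.ne', eq_comm, div_eq_zero_iff] at hdn
      exact hdn.elim (pow_ne_zero _ hτb0) (pow_ne_zero _ hb0)
    -- This quotient is a root of unity, so it lies in `K` and h₀ fixes it. But h₀ also multiplies
    -- it by u², where u is the value of f at h₀.
    have hω : (b * d / τ b) ^ n = 1 := by
      rw [div_pow, mul_pow, hdn]
      field_simp
    obtain ⟨i, -, hi⟩ := (hζ.map_of_injective (algebraMap K Ω).injective).eq_pow_of_pow_eq_one hω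
    have h1 : h₀ (b * d / τ b) = b * d / τ b := by
      rw [← hi, ← map_pow, AlgEquiv.commutes]
    rw [map_div₀, map_mul, hd h₀ hh₀, hb ⟨h₀, hh₀⟩, hτb ⟨h₀, hh₀⟩] at h1
    set u := f ⟨h₀, hh₀⟩ with hu
    have hu2 : u ^ 2 = 1 := by
      have hu0 : algebraMap K Ω u ≠ 0 := (map_ne_zero _).mpr u.ne_zero
      rw [Units.val_inv_eq_inv_val, map_inv₀] at h1
      field_simp at h1
      rw [← map_pow, map_eq_one_iff _ (algebraMap K Ω).injective] at h1
      exact Units.ext h1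
    have hu1 : u = 1 := by
      have h2 := hfn ⟨h₀, hh₀⟩
      rwa [← hu, hm₀, pow_add, pow_mul, hu2, one_pow, one_mul, pow_one] at h2
    exact hψ hu1
  -- Off H, z is constant with value z(τ) and g inverts; the coboundary of the witness is
  -- z(τ)^(-2m₀) = z(τ)^(1-n) = z(τ).
  refine ⟨z τ ^ m₀, fun g => ?_⟩
  by_cases hg : g ∈ H
  · rw [htriv g hg, div_self', hzH g hg]
  · rw [hinv g hg]
    have h1 : z g = z τ := by
      have h2 := hzc τ (τ⁻¹ * g)
      rwa [mul_inv_cancel_left, hzH _ (hH g hg), smul_one, one_mul] at h2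
    have h2 := hM (z τ)
    rw [h1, div_eq_iff_eq_mul, ← mul_left_inj (z τ ^ m₀), inv_mul_cancel, ← h2, hm₀]
    rw [mul_assoc, ← pow_add, ← pow_succ']
    congr 1
    ring

/-! ### Triviality of principal homogeneous spaces -/

/-- A geometric point fixed by the Galois group is rational. -/
lemma exists_rational_point_of_forall_smul_eq {k : Type u} [Field k] [PerfectField k]
    {X : Over (Spec (.of k))} [LocallyOfFiniteType X.hom] (P : GeomPoints X)
    (hP : ∀ σ : AbsGal k, σ • P = P) :
    Nonempty (𝟙_ (Over (Spec (.of k))) ⟶ X) := by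
  obtain ⟨A, j, g, _, ⟨y, hy⟩, hj, -⟩ :=
    exists_affine_factor X (P.left (IsLocalRing.closedPoint (AlgebraicClosure k)))
  have hr : Set.range P.left ⊆ Set.range j := by
    rintro _ ⟨t, rfl⟩
    refine ⟨y, hy.trans ?_⟩
    congr 1
    exact Subsingleton.elim (α := PrimeSpectrum (AlgebraicClosure k)) _ _
  let q : Spec (.of (AlgebraicClosure k)) ⟶ Spec A := IsOpenImmersion.lift j P.left hr
  have hq : q ≫ j = P.left := IsOpenImmersion.lift_fac _ _ _
  obtain ⟨ψ, hψ⟩ : ∃ ψ, Spec.map ψ = q := ⟨_, Spec.map_preimage q⟩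
  have hk : ∀ a : k, ψ.hom (g.hom a) = algebraMap k (AlgebraicClosure k) a := by
    have h1 : Spec.map (g ≫ ψ) = specExt k (AlgebraicClosure k) := by
      rw [Spec.map_comp, hψ, ← hj, ← Category.assoc, hq]
      exact Over.w P
    have h2 := Spec.map_injective h1
    intro a
    exact congrArg (fun f => f.hom a) h2
  -- Invariance of P puts the coordinates in the Galois-fixed field, which is `k` since `k` is
  -- perfect.
  have hfix : ∀ a : A, ∃ c : k, algebraMap k (AlgebraicClosure k) c = ψ.hom a := by
    intro a
    have : ψ.hom a ∈ Set.range (algebraMap k (AlgebraicClosure k)) := by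
      rw [InfiniteGalois.mem_range_algebraMap_iff_fixed]
      intro σ
      have h1 : specAut σ ≫ q = q := by
        rw [← cancel_mono j, Category.assoc, hq]
        exact congrArg CommaMorphism.left (hP σ)
      rw [← hψ, ← Spec.map_comp] at h1
      exact congrArg (fun f => f.hom a) (Spec.map_injective h1)
    exact this
  let := g.hom.toAlgebra
  let ψ' : A →ₐ[k] AlgebraicClosure k := { ψ.hom with commutes' := hk }
  let θ : A →ₐ[k] k :=
    (Algebra.botEquivOfInjective (algebraMap k (AlgebraicClosure k)).injective).toAlgHom.comp
      (ψ'.codRestrict ⊥ fun a => Algebra.mem_bot.mpr (hfix a))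
  refine ⟨Over.homMk (Spec.map (CommRingCat.ofHom θ.toRingHom) ≫ j) ?_⟩
  rw [Category.assoc]
  erw [hj]
  rw [← Spec.map_comp]
  change _ = 𝟙 _
  rw [← Spec.map_id]
  congr 1
  ext a
  exact θ.commutes a

namespace PrincipalHomogeneousSpace

variable {k : Type u} [Field k] {E : Over (Spec (.of k))} [GrpObj E]

/-- A principal homogeneous space with a rational point is trivial. -/
lemma isTrivial_of_rational_point (X : PrincipalHomogeneousSpace E)
    (s : 𝟙_ (Over (Spec (.of k))) ⟶ X.C) : X.IsTrivial := by
  let : ModObj E E := ModObj.regular E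
  -- This is the orbit map of s; on `T`-points, simple transitivity says that it is bijective.
  let f : E ⟶ X.C := (𝟙 E : E ⟶ E) • (toUnit E ≫ s)
  have hf : ∀ {T : Over (Spec (.of k))} (e : T ⟶ E), e ≫ f = e • (toUnit T ≫ s) := by
    intro T e
    rw [ModObj.comp_smul, Category.comp_id, comp_toUnit_assoc]
  have : IsIso f := by
    rw [isIso_iff_yoneda_map_bijective]
    intro T
    rw [Function.bijective_iff_existsUnique]
    intro y
    simpa only [hf] using ModObj.isIso_leftSMul_iff.mp X.simplyTransitive T (toUnit T ≫ s) y
  have : IsModHom E f := by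
    refine ⟨?_⟩
    have hmul : γ[E, E] = fst E E * snd E E := by
      rw [Hom.mul_def, lift_fst_snd, Category.id_comp, ModObj.smul_eq_mul]
    change γ[E, E] ≫ f = (E ◁ f) ≫ γ[E, X.C]
    rw [hmul]
    have h1 := hf (fst E E * snd E E)
    rw [mul_smul, ← hf, Hom.smul_def] at h1
    rw [h1]
    congr 1
  refine ⟨(asIso f).symm, ⟨?_⟩⟩
  rw [Iso.symm_hom, asIso_inv, IsIso.comp_inv_eq, Category.assoc,
    IsModHom.smul_hom (A := E) (f := f)]
  change γ[E, X.C] = (E ◁ inv f) ≫ (E ◁ f) ≫ γ[E, X.C]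
  rw [← MonoidalCategory.whiskerLeft_comp_assoc, IsIso.inv_hom_id, MonoidalCategory.whiskerLeft_id,
    Category.id_comp]

variable [IsEllipticCurve E]

/-- A principal homogeneous space with trivial class is trivial. -/
lemma isTrivial_of_wcClass_eq_one [PerfectField k] (X : PrincipalHomogeneousSpace E)
    (h : X.wcClass = 1) : X.IsTrivial := by
  obtain ⟨P⟩ := nonempty_geomPoints X.C
  rw [X.wcClass_eq P, QuotientGroup.eq_one_iff] at h
  obtain ⟨a, ha⟩ := h
  -- The cocycle of P is the coboundary of a, so translating P by the inverse of a makes it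
  -- Galois-fixed.
  have hfix : ∀ σ : AbsGal k, σ • (a⁻¹ • P) = a⁻¹ • P := by
    intro σ
    have h1 : σ • a / a = X.diff P (σ • P) := ha σ
    have h2 : σ • a = X.diff P (σ • P) * a := by rw [← h1, div_mul_cancel]
    rw [X.gal_smul_smul, smul_inv', h2, mul_inv, mul_comm, mul_smul]
    congr 1
    rw [inv_smul_eq_iff, X.diff_smul]
  obtain ⟨s⟩ := exists_rational_point_of_forall_smul_eq _ hfix
  exact X.isTrivial_of_rational_point s

end PrincipalHomogeneousSpace

/-! ### Divisibility of the group of geometric points -/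

/-- A proper specialization of x would give a chain of three irreducible closed sets, too long for
dimension at most one. -/
lemma isClosed_singleton_of_ne_genericPoint {X : Type*} [TopologicalSpace X] [QuasiSober X]
    [T0Space X] [IrreducibleSpace X] (hdim : topologicalKrullDim X ≤ 1) {x : X}
    (hx : x ≠ genericPoint X) : IsClosed ({x} : Set X) := by
  let C (y : X) : TopologicalSpace.IrreducibleCloseds X :=
    ⟨closure {y}, isIrreducible_singleton.closure, isClosed_closure⟩
  have hC : ∀ y z : X, z ∈ closure {y} → z ≠ y → C z < C y := by
    intro y z hz hne
    refine lt_of_le_of_ne (closure_minimal (Set.singleton_subset_iff.mpr hz) isClosed_closure) ?_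
    intro h
    have h1 : closure {z} = closure {y} := congrArg TopologicalSpace.IrreducibleCloseds.carrier h
    exact hne ((inseparable_iff_closure_eq.mpr h1).eq)
  have hsub : closure {x} ⊆ {x} := by
    intro w hw
    by_contra hne
    let s : LTSeries (TopologicalSpace.IrreducibleCloseds X) :=
      ⟨2, ![C w, C x, C (genericPoint X)], fun i => by
        fin_cases i
        · exact hC x w hw hne
        · exact hC _ _ (by rw [genericPoint_closure]; trivial) hx⟩
    have h1 : ((s.length : ℕ) : WithBot ℕ∞) ≤ 1 := (Order.LTSeries.length_le_krullDim s).trans hdim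
    have h2 : s.length = 2 := rfl
    rw [h2] at h1
    norm_cast at h1
  exact closure_eq_iff_isClosed.mp (hsub.antisymm subset_closure)

/-- The point of the underlying space of `X` below a geometric point. -/
noncomputable abbrev GeomPoints.image {k : Type u} [Field k] {X : Over (Spec (.of k))}
    (P : GeomPoints X) : X.left :=
  P.left (IsLocalRing.closedPoint (AlgebraicClosure k))

lemma GeomPoints.image_comp {k : Type u} [Field k] {X Y : Over (Spec (.of k))} (P : GeomPoints X)
    (f : X ⟶ Y) : GeomPoints.image (P ≫ f) = f.left P.image := rfl

/-- Every closed point of a scheme locally of finite type over `k` lies below a geometric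
point. -/
lemma exists_geomPoint_image_eq {k : Type u} [Field k] (X : Over (Spec (.of k)))
    [LocallyOfFiniteType X.hom] {x : X.left} (hx : IsClosed ({x} : Set X.left)) :
    ∃ P : GeomPoints X, P.image = x := by
  obtain ⟨A, j, g, _, ⟨y, hy⟩, hj, hg⟩ := exists_affine_factor X x
  have hyc : IsClosed ({y} : Set (Spec A)) := by
    have : ({y} : Set (Spec A)) = j ⁻¹' {x} := by
      ext w
      rw [Set.mem_preimage, Set.mem_singleton_iff, Set.mem_singleton_iff, ← hy]
      exact j.isOpenEmbedding.injective.eq_iff.symm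
    rw [this]
    exact hx.preimage j.continuous
  have hM : y.asIdeal.IsMaximal := (PrimeSpectrum.isClosed_singleton_iff_isMaximal y).mp hyc
  let := Ideal.Quotient.field y.asIdeal
  let : Algebra k A := g.hom.toAlgebra
  have : Algebra.FiniteType k A := hg
  have : Algebra.FiniteType k (A ⧸ y.asIdeal) :=
    Algebra.FiniteType.of_surjective (Ideal.Quotient.mkₐ k y.asIdeal) Ideal.Quotient.mk_surjective
  have : Module.Finite k (A ⧸ y.asIdeal) := finite_of_finite_type_of_isJacobsonRing k _
  let θ : (A ⧸ y.asIdeal) →ₐ[k] AlgebraicClosure k := IsAlgClosed.lift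
  let ψ : A →ₐ[k] AlgebraicClosure k := θ.comp (Ideal.Quotient.mkₐ k y.asIdeal)
  refine ⟨Over.homMk (Spec.map (CommRingCat.ofHom ψ.toRingHom) ≫ j) ?_, ?_⟩
  · rw [Category.assoc]
    erw [hj]
    rw [← Spec.map_comp]
    change Spec.map _ = Spec.map _
    congr 1
    ext a
    exact ψ.commutes a
  · rw [← hy]
    change j (Spec.map (CommRingCat.ofHom ψ.toRingHom) _) = j y
    congr 1
    refine PrimeSpectrum.ext (Ideal.ext fun a => ?_)
    change ψ a ∈ IsLocalRing.maximalIdeal (AlgebraicClosure k) ↔ _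
    rw [IsLocalRing.maximalIdeal_eq_bot, Ideal.mem_bot]
    change θ (Ideal.Quotient.mk _ a) = 0 ↔ _
    rw [map_eq_zero_iff θ θ.injective, Ideal.Quotient.eq_zero_iff_mem]

/-- Two homomorphisms into an algebraic closure with the same kernel are conjugate. -/
lemma AlgHom.exists_comp_eq_of_ker_eq {k A Ω : Type*} [Field k] [CommRing A] [Algebra k A]
    [Field Ω] [Algebra k Ω] [Normal k Ω] (f g : A →ₐ[k] Ω)
    (h : ∀ a, f a = 0 ↔ g a = 0) : ∃ σ : Ω ≃ₐ[k] Ω, (σ : Ω →ₐ[k] Ω).comp f = g := by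
  let F : IntermediateField k Ω := f.range.toIntermediateField' <|
    Subalgebra.isField_of_algebraic f.range
  have hF : ∀ x : F, ∃ a, f a = x := fun x => x.2
  choose r hr using hF
  have hfg : ∀ a b, f a = f b → g a = g b := fun a b hab => by
    rw [← sub_eq_zero, ← map_sub, ← h, map_sub, hab, sub_self]
  -- The rule f(a) ↦ g(a) is well defined because the kernels agree; normality extends it to Ω.
  let φ : F →ₐ[k] Ω :=
    { toFun := fun x => g (r x)
      map_one' := (hfg _ 1 (by rw [hr, map_one]; rfl)).trans (map_one g)
      map_mul' := fun x y => (hfg _ (r x * r y) (by rw [map_mul, hr, hr, hr]; rfl)).trans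
        (map_mul g _ _)
      map_zero' := (hfg _ 0 (by rw [hr, map_zero]; rfl)).trans (map_zero g)
      map_add' := fun x y => (hfg _ (r x + r y) (by rw [map_add, hr, hr, hr]; rfl)).trans
        (map_add g _ _)
      commutes' := fun c => (hfg _ (algebraMap k A c) (by rw [hr, f.commutes]; rfl)).trans
        (g.commutes c) }
  refine ⟨AlgEquiv.ofBijective (φ.liftNormal Ω) (Algebra.IsAlgebraic.algHom_bijective _), ?_⟩
  ext a
  have h1 := φ.liftNormal_commutes Ω ⟨f a, a, rfl⟩
  exact h1.trans (hfg _ _ (hr _))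

/-- Geometric points over the same point are Galois conjugate. -/
lemma GeomPoints.exists_smul_eq_of_image_eq {k : Type u} [Field k] {X : Over (Spec (.of k))}
    [LocallyOfFiniteType X.hom] (P Q : GeomPoints X) (h : P.image = Q.image) :
    ∃ σ : AbsGal k, σ • P = Q := by
  obtain ⟨A, j, g, _, ⟨y, hy⟩, hj, -⟩ := exists_affine_factor X P.image
  let : Algebra k A := g.hom.toAlgebra
  have key : ∀ R : GeomPoints X, j y = R.image → ∃ ψ : A →ₐ[k] AlgebraicClosure k,
      Spec.map (CommRingCat.ofHom ψ.toRingHom) ≫ j = R.left ∧ ∀ a, ψ a = 0 ↔ a ∈ y.asIdeal := by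
    intro R hR
    have hr : Set.range R.left ⊆ Set.range j := by
      rintro _ ⟨t, rfl⟩
      refine ⟨y, hR.trans ?_⟩
      refine congrArg R.left ?_
      exact Subsingleton.elim (α := PrimeSpectrum (AlgebraicClosure k)) _ _
    let q : Spec (.of (AlgebraicClosure k)) ⟶ Spec A := IsOpenImmersion.lift j R.left hr
    have hq : q ≫ j = R.left := IsOpenImmersion.lift_fac _ _ _
    obtain ⟨ψ, hψ⟩ : ∃ ψ, Spec.map ψ = q := ⟨_, Spec.map_preimage q⟩
    have hk : ∀ a : k, ψ.hom (g.hom a) = algebraMap k (AlgebraicClosure k) a := by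
      have h1 : Spec.map (g ≫ ψ) = specExt k (AlgebraicClosure k) := by
        rw [Spec.map_comp, hψ, ← hj, ← Category.assoc, hq]
        exact Over.w R
      have h2 := Spec.map_injective h1
      intro a
      exact congrArg (fun f => f.hom a) h2
    refine ⟨{ ψ.hom with commutes' := hk }, ?_, fun a => ?_⟩
    · rw [← hq, ← hψ]
      rfl
    · have h1 : q (IsLocalRing.closedPoint (AlgebraicClosure k)) = y := by
        apply j.isOpenEmbedding.injective
        rw [hR]
        exact congrArg (fun f => f (IsLocalRing.closedPoint (AlgebraicClosure k))) hq
      rw [← h1, ← hψ]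
      change ψ.hom a = 0 ↔ ψ.hom a ∈ IsLocalRing.maximalIdeal (AlgebraicClosure k)
      rw [IsLocalRing.maximalIdeal_eq_bot, Ideal.mem_bot]
  obtain ⟨f₁, hf₁, hf₁'⟩ := key P hy
  obtain ⟨f₂, hf₂, hf₂'⟩ := key Q (hy.trans h)
  obtain ⟨σ, hσ⟩ := AlgHom.exists_comp_eq_of_ker_eq f₁ f₂ fun a => (hf₁' a).trans (hf₂' a).symm
  refine ⟨σ, ?_⟩
  ext1
  change specAut σ ≫ P.left = Q.left
  rw [← hf₁, ← hf₂, ← Category.assoc, ← Spec.map_comp]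
  congr 2
  ext a
  exact congrArg (fun f => f a) hσ

section Divisibility

variable {k : Type u} [Field k] (E : Over (Spec (.of k))) [GrpObj E] [IsEllipticCurve E]

instance IsEllipticCurve.isIntegral_left : IsIntegral E.left :=
  GeometricallyIntegral.isIntegral_of_subsingleton E.hom

/-- An elliptic curve has infinitely many geometric points. -/
lemma IsEllipticCurve.infinite_geomPoints : Infinite (GeomPoints E) := by
  by_contra hinf
  rw [not_infinite_iff_finite] at hinf
  have : JacobsonSpace E.left := LocallyOfFiniteType.jacobsonSpace E.hom
  -- Finitely many closed points form a closed set, dense by the Jacobson property. Then the generic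
  -- point is closed, the space is a single point, and the dimension is 0.
  have hcl : (closedPoints E.left).Finite := by
    refine (Set.finite_range (GeomPoints.image (X := E))).subset fun x hx => ?_
    exact exists_geomPoint_image_eq E hx
  have hclosed : IsClosed (closedPoints E.left) := by
    rw [← Set.biUnion_of_singleton (closedPoints E.left)]
    exact hcl.isClosed_biUnion fun x hx => hx
  have huniv : closedPoints E.left = Set.univ := by
    rw [← closure_closedPoints, hclosed.closure_eq]
  have hξ : IsClosed ({genericPoint E.left} : Set E.left) := by
    have : genericPoint E.left ∈ closedPoints E.left := huniv ▸ Set.mem_univ _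
    exact this
  have hsub : Subsingleton E.left := by
    rw [← Set.subsingleton_univ_iff, ← genericPoint_closure, hξ.closure_eq]
    exact Set.subsingleton_singleton
  have h0 : topologicalKrullDim E.left ≤ 0 := topologicalKrullDim_zero_of_discreteTopology _
  rw [IsEllipticCurve.dim_eq_one] at h0
  exact absurd h0 (by norm_num)

/-- If the `n`-torsion of an elliptic curve is finite, then its group of geometric points is
`n`-divisible. -/
lemma IsEllipticCurve.exists_pow_eq (n : ℕ) (hfin : Finite (torsionPoints n E (specBar k)))
    (P : GeomPoints E) : ∃ Q : GeomPoints E, Q ^ n = P := by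
  let f : E ⟶ E := (𝟙 E) ^ n
  have hf : ∀ Q : GeomPoints E, Q ≫ f = Q ^ n := fun Q => by
    rw [MonObj.comp_pow, Category.comp_id]
  have hprop : IsProper f.left := by
    have : IsProper (f.left ≫ E.hom) := by rw [Over.w]; infer_instance
    exact IsProper.of_comp f.left E.hom
  have himage : ∀ Q : GeomPoints E, f.left Q.image = GeomPoints.image (Q ^ n) := fun Q => by
    rw [← hf, GeomPoints.image_comp]
  -- Matching underlying points is enough: Qⁿ and P are then conjugate, and conjugation commutes
  -- with powers.
  have hconj : ∀ Q : GeomPoints E, f.left Q.image = P.image → ∃ R : GeomPoints E, R ^ n = P := by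
    intro Q hQ
    rw [himage] at hQ
    obtain ⟨σ, hσ⟩ := GeomPoints.exists_smul_eq_of_image_eq _ _ hQ
    exact ⟨σ • Q, by rw [← smul_pow', hσ]⟩
  have hdim : topologicalKrullDim E.left ≤ 1 := IsEllipticCurve.dim_eq_one.le
  set ξ := genericPoint E.left
  -- A closed map has closed image, so multiplication by `n` is either surjective on points or
  -- constant, according to whether ξ maps to itself.
  have hrange : Set.range f.left = closure {f.left ξ} := by
    rw [← Set.image_singleton, f.left.isClosedMap.closure_image_eq_of_continuous f.left.continuous,
      genericPoint_closure, Set.image_univ]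
  by_cases hgen : f.left ξ = ξ
  · obtain ⟨w, hw⟩ : P.image ∈ Set.range f.left := by
      rw [hrange, hgen, genericPoint_closure]
      trivial
    -- If the preimage is the generic point, it need not be closed; but then P itself lies over ξ,
    -- which f fixes, and P serves as Q.
    by_cases hwξ : w = ξ
    · rw [hwξ, hgen] at hw
      exact hconj P (by rw [← hw, hgen])
    · obtain ⟨Q, hQ⟩ := exists_geomPoint_image_eq E
        (isClosed_singleton_of_ne_genericPoint hdim hwξ)
      exact hconj Q (by rw [hQ, hw])
  · exfalso
    have hcl : IsClosed ({f.left ξ} : Set E.left) := isClosed_singleton_of_ne_genericPoint hdim hgen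
    rw [hcl.closure_eq] at hrange
    have hconst : ∀ x, f.left x = f.left ξ := fun x => by
      have : f.left x ∈ Set.range f.left := ⟨x, rfl⟩
      rwa [hrange] at this
    -- In the constant case Qⁿ and 1 lie over the same point, so they are conjugate, and 1 is
    -- Galois-fixed. Infinitely many torsion points result.
    have htors : ∀ Q : GeomPoints E, Q ∈ torsionPoints n E (specBar k) := by
      intro Q
      have h1 : GeomPoints.image (1 : GeomPoints E) = GeomPoints.image (Q ^ n) := by
        rw [← himage, hconst, ← hconst (GeomPoints.image (1 : GeomPoints E)), himage, one_pow]
      obtain ⟨σ, hσ⟩ := GeomPoints.exists_smul_eq_of_image_eq _ _ h1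
      change Q ^ n = 1
      rw [← hσ, smul_one]
    have : Finite (GeomPoints E) :=
      Finite.of_injective (fun Q => (⟨Q, htors Q⟩ : torsionPoints n E (specBar k)))
        fun Q R h => congrArg Subtype.val h
    exact (IsEllipticCurve.infinite_geomPoints E).not_finite this

end Divisibility

/-! ### Geometric points of a base change and of a quadratic twist -/

section Twist

variable {k L : Type u} [Field k] [Field L] [Algebra k L] (i : L →ₐ[k] AlgebraicClosure k)

/-- `Spec k̄` as an `L`-scheme, for an embedding `L → k̄`. -/
noncomputable abbrev specBarOver : Over (Spec (.of L)) :=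
  Over.mk (Spec.map (CommRingCat.ofHom (i : L →+* AlgebraicClosure k)))

lemma specMap_comp_specExt :
    Spec.map (CommRingCat.ofHom (i : L →+* AlgebraicClosure k)) ≫ specExt k L =
      specExt k (AlgebraicClosure k) := by
  rw [← Spec.map_comp, ← CommRingCat.ofHom_comp]
  congr 2
  ext x
  exact i.commutes x

/-- The geometric point of `X` induced by a geometric point of `X_L`. -/
noncomputable def toGeomPoint {X : Over (Spec (.of k))} (a : specBarOver i ⟶ baseChangeTo L X) :
    GeomPoints X :=
  Over.homMk (a.left ≫ Limits.pullback.fst X.hom (specExt k L)) (by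
    refine Eq.trans ?_ (specMap_comp_specExt i)
    rw [Category.assoc, Limits.pullback.condition, ← Category.assoc]
    congr 1
    exact Over.w a)

/-- The geometric point of `X_L` induced by a geometric point of `X`. -/
noncomputable def ofGeomPoint {X : Over (Spec (.of k))} (P : GeomPoints X) :
    specBarOver i ⟶ baseChangeTo L X :=
  Over.homMk (Limits.pullback.lift P.left
    (Spec.map (CommRingCat.ofHom (i : L →+* AlgebraicClosure k)))
    ((Over.w P).trans (specMap_comp_specExt i).symm)) (Limits.pullback.lift_snd _ _ _)

lemma toGeomPoint_ofGeomPoint {X : Over (Spec (.of k))} (P : GeomPoints X) :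
    toGeomPoint i (ofGeomPoint i P) = P := by
  ext1
  exact Limits.pullback.lift_fst _ _ _

lemma ofGeomPoint_toGeomPoint {X : Over (Spec (.of k))}
    (a : specBarOver i ⟶ baseChangeTo L X) : ofGeomPoint i (toGeomPoint i a) = a := by
  ext1
  refine Limits.pullback.hom_ext (Limits.pullback.lift_fst _ _ _) ?_
  exact (Limits.pullback.lift_snd _ _ _).trans (Over.w a).symm

lemma toGeomPoint_comp_map {X Y : Over (Spec (.of k))} (a : specBarOver i ⟶ baseChangeTo L X)
    (f : X ⟶ Y) :
    toGeomPoint i (a ≫ (Over.pullback (specExt k L)).map f) = toGeomPoint i a ≫ f := by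
  ext1
  change (a.left ≫ ((Over.pullback (specExt k L)).map f).left) ≫
    Limits.pullback.fst Y.hom (specExt k L) =
      (a.left ≫ Limits.pullback.fst X.hom (specExt k L)) ≫ f.left
  rw [Category.assoc, Category.assoc]
  congr 1
  exact Limits.pullback.lift_fst _ _ _

/-- The group law of the base change is the image of that of `X` under the monoidal pullback
functor, so the two products are compared on the two projections. -/
lemma toGeomPoint_mul {X : Over (Spec (.of k))} [GrpObj X]
    (a b : specBarOver i ⟶ baseChangeTo L X) :
    toGeomPoint i (a * b) = toGeomPoint i a * toGeomPoint i b := by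
  rw [Hom.mul_def, Hom.mul_def, Functor.obj.μ_def, ← Category.assoc, toGeomPoint_comp_map]
  congr 1
  ext1
  · rw [← toGeomPoint_comp_map, Category.assoc, Functor.Monoidal.μ_fst, lift_fst, lift_fst]
  · rw [← toGeomPoint_comp_map, Category.assoc, Functor.Monoidal.μ_snd, lift_snd, lift_snd]

/-- Geometric points of `X_L` and of `X` agree. -/
noncomputable def geomPointEquiv (X : Over (Spec (.of k))) [GrpObj X] :
    (specBarOver i ⟶ baseChangeTo L X) ≃* GeomPoints X where
  toFun := toGeomPoint i
  invFun := ofGeomPoint i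
  left_inv := ofGeomPoint_toGeomPoint i
  right_inv := toGeomPoint_ofGeomPoint i
  map_mul' := toGeomPoint_mul i

/-- Galois conjugation of a geometric point of `X` in terms of the semilinear automorphism of
`X_L`. -/
lemma specAut_comp_ofGeomPoint {X : Over (Spec (.of k))} (P : GeomPoints X) {g : AbsGal k}
    {σ : L ≃ₐ[k] L} (hg : ∀ x, g (i x) = i (σ x)) :
    specAut g ≫ (ofGeomPoint i P).left = (ofGeomPoint i (g • P)).left ≫ semilinearAut σ X := by
  apply Limits.pullback.hom_ext
  · simp only [ofGeomPoint, semilinearAut, Over.homMk_left, Category.assoc,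
      Limits.pullback.lift_fst]
    rfl
  · have h1 : specAut g ≫ Spec.map (CommRingCat.ofHom (i : L →+* AlgebraicClosure k)) =
        Spec.map (CommRingCat.ofHom (i : L →+* AlgebraicClosure k)) ≫ specAut σ := by
      rw [← Spec.map_comp, ← Spec.map_comp, ← CommRingCat.ofHom_comp, ← CommRingCat.ofHom_comp]
      congr 2
      ext x
      exact hg x
    simp only [ofGeomPoint, semilinearAut, Over.homMk_left, Category.assoc,
      Limits.pullback.lift_snd, Limits.pullback.lift_snd_assoc]
    exact h1

lemma semilinearAut_one (X : Over (Spec (.of k))) :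
    semilinearAut (1 : L ≃ₐ[k] L) X = 𝟙 _ := by
  apply Limits.pullback.hom_ext
  · rw [semilinearAut, Limits.pullback.lift_fst, Category.id_comp]
  · rw [semilinearAut, Limits.pullback.lift_snd, Category.id_comp]
    have : specAut (1 : L ≃ₐ[k] L) = 𝟙 _ := Spec.map_id _
    rw [this, Category.comp_id]

/-- The group of geometric points of a quadratic twist is the twist of the group of geometric points
by the quadratic character. -/
lemma IsQuadraticTwist.exists_geomPoints_equiv {E E' : Over (Spec (.of k))} [GrpObj E] [GrpObj E']
    (h : IsQuadraticTwist L E E') :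
    ∃ Φ : GeomPoints E ≃* GeomPoints E', ∀ (g : AbsGal k) (σ : L ≃ₐ[k] L),
      (∀ x, g (i x) = i (σ x)) → ∀ P,
        (σ = 1 → g • Φ P = Φ (g • P)) ∧ (σ ≠ 1 → g • Φ P = (Φ (g • P))⁻¹) := by
  obtain ⟨φ, _, hφ⟩ := h
  let Ψ : (specBarOver i ⟶ baseChangeTo L E) ≃* (specBarOver i ⟶ baseChangeTo L E') :=
    { toFun := fun a => a ≫ φ.hom
      invFun := fun a => a ≫ φ.inv
      left_inv := fun a => by simp
      right_inv := fun a => by simp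
      map_mul' := fun a b => MonObj.mul_comp a b φ.hom }
  refine ⟨((geomPointEquiv i E).symm.trans Ψ).trans (geomPointEquiv i E'), fun g σ hg P => ?_⟩
  have hΦ : ∀ Q, (((geomPointEquiv i E).symm.trans Ψ).trans (geomPointEquiv i E')) Q =
    toGeomPoint i (ofGeomPoint i Q ≫ φ.hom) := fun _ => rfl
  -- Moving g across the identification of points of `E` with points of its base change turns it
  -- into the semilinear automorphism of σ, to which the twisting condition applies.
  have hleft : (g • toGeomPoint i (ofGeomPoint i P ≫ φ.hom)).left =
      (ofGeomPoint i (g • P)).left ≫ semilinearAut σ E ≫ φ.hom.left ≫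
        Limits.pullback.fst E'.hom (specExt k L) := by
    rw [← Category.assoc, ← specAut_comp_ofGeomPoint i P hg]
    change specAut g ≫ ((ofGeomPoint i P).left ≫ φ.hom.left) ≫ _ = _
    simp only [Category.assoc]
  rw [hΦ, hΦ]
  constructor
  · rintro rfl
    ext1
    rw [hleft, semilinearAut_one, Category.id_comp]
    exact (Category.assoc _ _ _).symm
  · intro hσ
    have hinv : (toGeomPoint i (ofGeomPoint i (g • P) ≫ φ.hom))⁻¹ =
        toGeomPoint i (ofGeomPoint i (g • P) ≫ ι[baseChangeTo L E] ≫ φ.hom) := by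
      rw [← Category.assoc, ← Hom.inv_def]
      exact (map_inv (Ψ.trans (geomPointEquiv i E')) (ofGeomPoint i (g • P))).symm
    rw [hinv]
    ext1
    rw [hleft, ← Category.assoc (semilinearAut σ E), hφ σ hσ]
    -- The semilinear automorphism only moves the factor `Spec L`, so it disappears on projecting to
    -- `E'`.
    have h1 : semilinearAut σ E' ≫ Limits.pullback.fst E'.hom (specExt k L) =
        Limits.pullback.fst E'.hom (specExt k L) := Limits.pullback.lift_fst _ _ _
    rw [Category.assoc, h1]
    exact (Category.assoc _ _ _).symm

end Twist

/-! ### The Galois module of torsion points -/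

section Torsion

variable {k : Type u} [Field k] {n : ℕ} {E : Over (Spec (.of k))} [GrpObj E] [IsEllipticCurve E]

/-- The Galois action on `E[n](k̄)`. -/
noncomputable instance torsionPoints.galAction :
    MulDistribMulAction (AbsGal k) (torsionPoints n E (specBar k)) where
  smul g x := torsionPoints.restrict (galAut g) x
  one_smul x := Subtype.ext (one_smul (AbsGal k) (x : GeomPoints E))
  mul_smul g h x := Subtype.ext (mul_smul g h (x : GeomPoints E))
  smul_mul g x y := Subtype.ext (smul_mul' g (x : GeomPoints E) (y : GeomPoints E))
  smul_one g := Subtype.ext (smul_one g : g • (1 : GeomPoints E) = 1)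

instance subsingleton_specBar : Subsingleton (specBar k).left :=
  inferInstanceAs (Subsingleton (PrimeSpectrum (AlgebraicClosure k)))

instance isIntegral_specBar : IsIntegral (specBar k).left :=
  inferInstanceAs (IsIntegral (Spec (.of (AlgebraicClosure k))))

/-- The torsion points of a curve with full level structure are finite in number. -/
lemma FullLevelStructure.finite_torsionPoints [NeZero n] (F : FullLevelStructure n E) :
    Finite (torsionPoints n E (specBar k)) := by
  have : Finite (LocallyConstant (specBar k).left (ZMod n)) := by
    refine Finite.of_injective (fun f => f (IsLocalRing.closedPoint (AlgebraicClosure k)))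
      fun f g h => LocallyConstant.ext fun x => ?_
    rw [Subsingleton.elim x (IsLocalRing.closedPoint (AlgebraicClosure k))]
    exact h
  have : Finite (Multiplicative (LocallyConstant (specBar k).left (ZMod n))) := this
  exact Finite.of_equiv _ (F.equiv (specBar k)).symm.toEquiv

/-- Over a field containing the `n`-th roots of unity, the Galois action on the `n`-torsion of a curve
with full level-`n` structure is trivial. -/
lemma FullLevelStructure.smul_torsionPoints_eq [NeZero n] (F : FullLevelStructure n E) {ζ : k}
    (hζ : IsPrimitiveRoot ζ n) (g : AbsGal k) (x : torsionPoints n E (specBar k)) : g • x = x := by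
  apply (F.equiv (specBar k)).injective
  change F.equiv (specBar k) (torsionPoints.restrict (galAut g) x) = _
  refine Prod.ext ?_ ?_
  · apply Multiplicative.toAdd.injective
    rw [F.naturality_fst]
    refine LocallyConstant.ext fun y => ?_
    rw [LocallyConstant.coe_comap_apply]
    congr 1
    exact Subsingleton.elim _ _
  -- The roots of unity over `Spec k̄` are powers of the image of ζ, which comes from `k`.
  · rw [F.naturality_snd]
    let s : k →+* Γ((specBar k).left, ⊤) :=
      ((specBar k).hom.appTop.hom).comp (Scheme.ΓSpecIso (.of k)).inv.hom
    have hs : ∀ a, (galAut g).left.appTop.hom (s a) = s a := by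
      intro a
      have h1 : (specBar k).hom.appTop ≫ (galAut g).left.appTop = (specBar k).hom.appTop := by
        rw [← Scheme.Hom.comp_appTop, Over.w]
      exact congrArg (fun f => f.hom ((Scheme.ΓSpecIso (.of k)).inv.hom a)) h1
    have hsζ : IsPrimitiveRoot (s ζ) n := hζ.map_of_injective s.injective
    ext
    set r := (F.equiv (specBar k) x).2
    have hr : ((r : Γ((specBar k).left, ⊤)ˣ) : Γ((specBar k).left, ⊤)) ^ n = 1 := by
      have := (mem_rootsOfUnity n _).mp r.2
      rw [← Units.val_pow_eq_pow_val, this, Units.val_one]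
    obtain ⟨j, -, hj⟩ := hsζ.eq_pow_of_pow_eq_one hr
    rw [restrictRootsOfUnity_coe_apply, ← hj, map_pow, hs]

end Torsion

/-! ### The Galois group of the quadratic extension, and the final assembly -/

/-- For a quadratic extension `L/k` of `p`-adic fields containing the `n`-th roots of unity, with `n`
odd and prime to `p`: the subgroup `H` of the absolute Galois group fixing `L`, an element `τ`
outside of it, and the fact that `τ` acts trivially on the `n`-th power classes of `L`. -/
lemma exists_galois_data_of_quadratic {p : ℕ} [Fact p.Prime] {n : ℕ} (hodd : Odd n)
    (hpn : ¬ p ∣ n) {k : Type u} [Field k] [Algebra ℚ_[p] k] [FiniteDimensional ℚ_[p] k] {ζ : k}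
    (hζ : IsPrimitiveRoot ζ n) {L : Type u} [Field L] [Algebra k L]
    (hL : Module.finrank k L = 2) (i : L →ₐ[k] AlgebraicClosure k) :
    ∃ (H : Subgroup (AbsGal k)) (τ : AbsGal k), IsOpen (H : Set (AbsGal k)) ∧ τ ∉ H ∧
      (∀ g, g ∉ H → τ⁻¹ * g ∈ H) ∧
      (∀ g, ∃ σ : L ≃ₐ[k] L, (∀ x, g (i x) = i (σ x)) ∧ (g ∈ H ↔ σ = 1)) ∧
      ∀ x : AlgebraicClosure k, x ≠ 0 → (∀ h ∈ H, h x = x) →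
        ∃ d : AlgebraicClosure k, (∀ h ∈ H, h d = d) ∧ d ^ n = τ x / x := by
  have : CharZero k := charZero_of_injective_algebraMap (algebraMap ℚ_[p] k).injective
  have : FiniteDimensional k L := Module.finite_of_finrank_pos (by omega)
  have : Algebra.IsQuadraticExtension k L := ⟨hL⟩
  have : IsGalois k L := ⟨⟩
  let : Algebra L (AlgebraicClosure k) := i.toRingHom.toAlgebra
  have : IsScalarTower k L (AlgebraicClosure k) :=
    IsScalarTower.of_algebraMap_eq fun x => (i.commutes x).symm
  let H : Subgroup (AbsGal k) := i.fieldRange.fixingSubgroup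
  have hH : ∀ g : AbsGal k, g ∈ H ↔ ∀ x, g (i x) = i x := fun g => by
    rw [IntermediateField.mem_fixingSubgroup_iff]
    exact ⟨fun h x => h _ ⟨x, rfl⟩, fun h => by rintro _ ⟨x, rfl⟩; exact h x⟩
  have hres : ∀ g : AbsGal k, ∃ σ : L ≃ₐ[k] L, (∀ x, g (i x) = i (σ x)) ∧ (g ∈ H ↔ σ = 1) := by
    intro g
    have h1 : ∀ x, g (i x) = i (g.restrictNormal L x) := fun x =>
      (g.restrictNormal_commutes L x).symm
    refine ⟨g.restrictNormal L, h1, ?_⟩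
    rw [hH]
    constructor
    · intro h
      ext x
      exact i.injective ((h1 x).symm.trans (h x))
    · intro h x
      rw [h1, h]
      rfl
  have hcard : Nat.card (L ≃ₐ[k] L) = 2 := by rw [IsGalois.card_aut_eq_finrank, hL]
  obtain ⟨σ, hσ, huniq⟩ := (Nat.card_eq_two_iff' (1 : L ≃ₐ[k] L)).mp hcard
  have hσσ : ∀ x, σ (σ x) = x := by
    have h1 : σ ^ 2 = 1 := by rw [← hcard, pow_card_eq_one']
    intro x
    have := congrArg (fun f : L ≃ₐ[k] L => f x) h1
    rwa [pow_two] at this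
  let τ : AbsGal k := σ.liftNormal (AlgebraicClosure k)
  have hτ : ∀ x, τ (i x) = i (σ x) := fun x => σ.liftNormal_commutes (AlgebraicClosure k) x
  have hτH : τ ∉ H := by
    rw [hH]
    intro h
    exact hσ (AlgEquiv.ext fun x => i.injective ((hτ x).symm.trans (h x)))
  have : FiniteDimensional k i.fieldRange :=
    (AlgEquiv.ofInjectiveField i).toLinearEquiv.finiteDimensional
  refine ⟨H, τ, i.fieldRange.fixingSubgroup_isOpen, hτH, fun g hg => ?_, hres, fun x hx0 hx => ?_⟩
  · obtain ⟨σ', hσ', hσ''⟩ := hres g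
    rw [hσ''] at hg
    rw [hH]
    intro x
    rw [AlgEquiv.mul_apply, hσ', huniq σ' hg, ← hτ, ← AlgEquiv.mul_apply, inv_mul_cancel,
      AlgEquiv.one_apply]
  -- By infinite Galois theory an H-fixed element comes from `L`, where the `p`-adic result applies.
  · have hxr : x ∈ i.fieldRange := by
      rw [← InfiniteGalois.fixedField_fixingSubgroup i.fieldRange]
      exact fun h => hx h h.2
    obtain ⟨x, rfl⟩ := hxr
    let : Algebra ℚ_[p] L := ((algebraMap k L).comp (algebraMap ℚ_[p] k)).toAlgebra
    have : IsScalarTower ℚ_[p] k L := IsScalarTower.of_algebraMap_eq fun _ => rfl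
    have : FiniteDimensional ℚ_[p] L := FiniteDimensional.trans ℚ_[p] k L
    have hx0' : x ≠ 0 := by rintro rfl; exact hx0 (map_zero i)
    obtain ⟨v, hv⟩ := exists_pow_eq_involution_div_of_padic p L hpn hodd (σ.restrictScalars ℚ_[p])
      hσσ (hζ.map_of_injective (algebraMap k L).injective) (σ.commutes ζ) hx0'
    refine ⟨i v, fun h hh => (hH h).mp hh v, ?_⟩
    rw [← map_pow, hv]
    change i (σ x / x) = τ (i x) / i x
    rw [hτ, map_div₀]

/-- If the period of a principal homogeneous space divides `n` and `E(k̄)` is `n`-divisible, then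
the class is represented by the cocycle of a geometric point with values in the `n`-torsion. -/
lemma PrincipalHomogeneousSpace.exists_cocycle_pow_eq_one {k : Type u} [Field k]
    {E : Over (Spec (.of k))} [GrpObj E] [IsEllipticCurve E] (C : PrincipalHomogeneousSpace E)
    {n : ℕ} (hn : C.period ∣ n) (hdiv : ∀ P : GeomPoints E, ∃ Q : GeomPoints E, Q ^ n = P) :
    ∃ P : GeomPoints C.C, ∀ g, ((C.cocycle P).1 g) ^ n = 1 := by
  obtain ⟨P⟩ := nonempty_geomPoints C.C
  rw [period, orderOf_dvd_iff_pow_eq_one, C.wcClass_eq P, ← QuotientGroup.mk_pow,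
    QuotientGroup.eq_one_iff] at hn
  obtain ⟨a, ha⟩ := hn
  obtain ⟨Q, rfl⟩ := hdiv a
  -- The `n`-th power of the cocycle of P is the coboundary of Qⁿ. Translating P by the inverse of Q
  -- divides the cocycle by the coboundary of Q, leaving values killed by `n`.
  refine ⟨Q⁻¹ • P, fun g => ?_⟩
  have h1 : (C.cocycle (Q⁻¹ • P)).1 g = C.diff P (g • P) / (g • Q / Q) := by
    refine (C.eq_diff ?_).symm
    rw [C.gal_smul_smul, smul_inv', ← mul_smul]
    conv_rhs => rw [← C.diff_smul P (g • P), ← mul_smul]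
    congr 1
    rw [div_div_eq_mul_div, mul_div_right_comm, mul_assoc, mul_inv_cancel, mul_one, div_eq_inv_mul]
  rw [h1, div_pow, div_eq_one, div_pow, ← smul_pow', ha g]
  rfl

theorem theorem4p4 (n : ℕ) (hn : 2 < n) (hodd : Odd n)
    (p : ℕ) [Fact p.Prime] (hp2 : p ≠ 2) (hpn : ¬ p ∣ n)
    (k : Type u) [Field k] [Algebra ℚ_[p] k] [FiniteDimensional ℚ_[p] k]
    (hζ : ∃ ζ : k, IsPrimitiveRoot ζ n)
    (E : Over (Spec (.of k))) [GrpObj E] [IsEllipticCurve E]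
    (hE : Nonempty (FullLevelStructure n E))
    (L : Type u) [Field L] [Algebra k L] (hL : Module.finrank k L = 2)
    (E' : Over (Spec (.of k))) [GrpObj E'] [IsEllipticCurve E']
    (hE' : IsQuadraticTwist L E E') :
    ¬ ∃ C : PrincipalHomogeneousSpace E', C.period ∣ n ∧ ¬ C.IsTrivial := by
  rintro ⟨C, hper, hnt⟩
  obtain ⟨ζ, hζ⟩ := hζ
  obtain ⟨F⟩ := hE
  have : NeZero n := ⟨by omega⟩
  have : CharZero k := charZero_of_injective_algebraMap (algebraMap ℚ_[p] k).injective
  have : FiniteDimensional k L := Module.finite_of_finrank_pos (by omega)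
  let i : L →ₐ[k] AlgebraicClosure k := IsAlgClosed.lift
  obtain ⟨H, τ, hHo, hτ, hHτ, hHσ, hpow⟩ := exists_galois_data_of_quadratic hodd hpn hζ hL i
  obtain ⟨Φ, hΦ⟩ := hE'.exists_geomPoints_equiv i
  have hmem : ∀ x : torsionPoints n E' (specBar k), ∃ y : torsionPoints n E (specBar k),
      Φ (y : GeomPoints E) = (x : GeomPoints E') := by
    intro x
    have hx : (x : GeomPoints E') ^ n = 1 := x.2
    refine ⟨⟨Φ.symm x, ?_⟩, Φ.apply_symm_apply _⟩
    change (Φ.symm (x : GeomPoints E')) ^ n = 1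
    rw [← map_pow, hx, map_one]
  have hact : ∀ (g : AbsGal k) (x : torsionPoints n E' (specBar k)),
      (g ∈ H → g • x = x) ∧ (g ∉ H → g • x = x⁻¹) := by
    intro g x
    obtain ⟨y, hy⟩ := hmem x
    obtain ⟨σ, hσ, hσH⟩ := hHσ g
    have hgy : g • (y : GeomPoints E) = y :=
      congrArg Subtype.val (F.smul_torsionPoints_eq hζ g y)
    have h1 := hΦ g σ hσ y
    rw [hgy, hy] at h1
    rw [hσH]
    exact ⟨fun h => Subtype.ext (h1.1 h), fun h => Subtype.ext (h1.2 h)⟩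
  -- Finiteness passes from `E` to its twist and is what the divisibility of `E'(k̄)` rests on.
  have hfin : Finite (torsionPoints n E' (specBar k)) := by
    have := F.finite_torsionPoints
    choose r hr using hmem
    refine Finite.of_injective r fun x y hxy => Subtype.ext ?_
    rw [← hr x, ← hr y, hxy]
  obtain ⟨P, hP⟩ := C.exists_cocycle_pow_eq_one hper (IsEllipticCurve.exists_pow_eq E' n hfin)
  let z : AbsGal k → torsionPoints n E' (specBar k) := fun g => ⟨(C.cocycle P).1 g, hP g⟩
  obtain ⟨a, ha⟩ := isMulCoboundary₁_of_quadratic_twist hodd hζ H hHo hτ hHτ hpow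
    (M := torsionPoints n E' (specBar k)) (fun m => Subtype.ext m.2)
    (fun g hg m => (hact g m).1 hg) (fun g hg m => (hact g m).2 hg) z
    (IsLocallyConstant.desc z Subtype.val (C.cocycle P).2.1 Subtype.val_injective)
    (fun g h => Subtype.ext ((C.cocycle P).2.2 g h))
  refine hnt (C.isTrivial_of_wcClass_eq_one ?_)
  rw [C.wcClass_eq P, QuotientGroup.eq_one_iff]
  exact ⟨a, fun g => congrArg Subtype.val (ha g)⟩
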